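/- **Setting.** Let $\mathcal M=(\mathcal S,\mathcal A,r,P,\rho)$ be a finite MDP with rewards $r:\mathcal S\times\mathcal A\to[0,1]$, transition probabilities $P(s'|s,a)$, initial distribution $\rho$, and $A=|\mathcal A|$. A policy $\pi$ assigns to each state $s$ a probability distribution $\pi(\cdot|s)$ on $\mathcal A$, and $P^\pi(s,s')=\sum_a P(s'|s,a)\pi(a|s)$. Assume that $\mathcal M$ is ergodic: for every policy $\pi$ the Markov chain $P^\pi$ is irreducible and aperiodic. Let $d^\pi$ be its stationary distribution, $J^\pi=\lim_{n\to\infty}\frac1n\mathbb E_\pi[\sum_{t<n}r(s_t,a_t)\mid s_0\sim\rho]$ the average reward, $V^\pi(s)=\sum_{t\ge0}(\mathbb E_\pi[r(s_t,a_t)|s_0=s]-J^\pi)$, $Q^\pi(s,a)=\sum_{t\ge0}(\mathbb E_\pi[r(s_t,a_t)|s_0=s,a_0=a]-J^\pi)$ and $A^\pi=Q^\pi-V^\pi$. Let $\pi^*$ maximize $J^\pi$ over all policies, and $J^*=J^{\pi^*}$. Let $(\pi_\theta)_{\theta\in\mathbb R^d}$, $d\ge1$, be policies with $\pi_\theta(a|s)>0$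 and $\theta\mapsto\log\pi_\theta(a|s)$ twice differentiable. Put $t_{\mathrm{mix}}=\sup_\theta\min\{t\ge1:\|(P^{\pi_\theta})^t(s,\cdot)-d^{\pi_\theta}\|_1\le\frac14\ \forall s\}$ and $t_{\mathrm{hit}}=\sup_\theta\max_s 1/d^{\pi_\theta}(s)$. Assume that, for all $\theta,s,a$: 1. $\|\nabla_\theta\log\pi_\theta(a|s)\|\le G$ and $\|\nabla^2_\theta\log\pi_\theta(a|s)\|\le B$; 2. $\mathbb E_{s\sim d^{\pi^*},a\sim\pi^*(\cdot|s)}[(\nabla_\theta\log\pi_\theta(a|s)\cdot\omega^*_\theta-A^{\pi_\theta}(s,a))^2]\le\epsilon_{\mathrm{bias}}$, where $\omega^*_\theta$ minimizes $\omega\mapsto\mathbb E_{s\sim d^{\pi_\theta},a\sim\pi_\theta(\cdot|s)}[(\nabla_\theta\log\pi_\theta(a|s)\cdot\omega-A^{\pi_\theta}(s,a))^2]$; 3. $F(\theta)-\mu I_d$ is positive semidefinite, where $\mu>0$ and $F(\theta)=\mathbb E_{s\sim d^{\pi_\theta},a\sim\pi_\theta(\cdot|s)}[\nabla_\theta\log\pi_\theta(a|s)\nabla_\theta\log\pi_\theta(a|s)^\top]$.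 **Algorithm.** Let $T\ge2$ be an integer, let $N$ be $7t_{\mathrm{mix}}\log_2T$ rounded up to an integer, let $H$ be $63\,t_{\mathrm{mix}}t_{\mathrm{hit}}(\log_2T)^2$ rounded up to an even integer, and let $\gamma_k=\frac{6G}{\mu(k+2)}$, $\eta_k=\frac2{k+2}$. For a trajectory $\tau=(s_t,a_t)_{t=0}^{\ell-1}$ of length $\ell=H/2$ and a state $s$, let $\xi_1<\dots<\xi_i$ be the times found by the following scan: start at $\xi=0$; while $\xi\le\ell-1-N$, record $\xi$ and increase it by $2N$ if $s_\xi=s$, and increase it by $1$ otherwise. With $y_j=\sum_{t=\xi_j}^{\xi_j+N-1}r(s_t,a_t)$ let $$\hat V(\tau,s)=\frac1i\sum_{j\le i}y_j,\qquad \hat q(\tau,s,a)=\frac1i\sum_{j\le i}y_j\mathbf 1(a_{\xi_j}=a)$$ (both $0$ if $i=0$), and $$g(\theta,\tau)=\frac1{\ell-N}\sum_{t=N}^{\ell-1}\Big(\frac{\hat q(\tau,s_t,a_t)}{\pi_\theta(a_t|s_t)}-\hat V(\tau,s_t)\Big)\nabla_\theta\log\pi_\theta(a_t|s_t),$$ $$\Phi(\theta,\tau)=\frac1{\ell-N}\sum_{t=N}^{\ell-1}\Big(-\hat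 V(\tau,s_t)\log\pi_\theta(a_t|s_t)-\frac{\hat q(\tau,s_t,a_t)}{\pi_\theta(a_t|s_t)}\Big),$$ $$B(\theta,\tau)=\nabla_\theta\Phi(\theta,\tau)\Big(\sum_{t=0}^{\ell-1}\nabla_\theta\log\pi_\theta(a_t|s_t)\Big)^{\!\top}+\nabla^2_\theta\Phi(\theta,\tau).$$ Start from arbitrary $\theta_0,\theta_1\in\mathbb R^d$, $d_0=0$ and $s_0\sim\rho$. In epoch $k=1,2,\dots$, which consists of the times $(k-1)H,\dots,kH-1$, draw a fresh independent $q_k$ uniformly from $[0,1]$, put $\hat\theta_k=q_k\theta_k+(1-q_k)\theta_{k-1}$, follow $\pi_{\theta_k}$ during the first $H/2$ steps (trajectory $\tau_k$) and $\pi_{\hat\theta_k}$ during the last $H/2$ steps (trajectory $\hat\tau_k$), without resetting the state, and then set $$d_k=(1-\eta_k)\big(d_{k-1}+B(\hat\theta_k,\hat\tau_k)(\theta_k-\theta_{k-1})\big)+\eta_k\,g(\theta_k,\tau_k),\qquad \theta_{k+1}=\theta_k+\gamma_k\frac{d_k}{\|d_k\|}$$ ($\theta_{k+1}=\theta_k$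 if $d_k=0$). The run is stopped at time $T$, so that there are $K=T/H$ epochs if $H$ divides $T$, and otherwise the last epoch is incomplete. **Theorem 2.** There is an absolute constant $C>0$ such that in every such setting, for every $T\ge2$ and all $\theta_0,\theta_1$, the regret $\mathrm{Reg}_T=\sum_{t=0}^{T-1}(J^*-r(s_t,a_t))$ is integrable and $$\mathbb E[\mathrm{Reg}_T]\le T\sqrt{\epsilon_{\mathrm{bias}}}+C\Big(\frac{\sqrt A\,G^2t_{\mathrm{mix}}\log T}{\mu}+\frac{\sqrt A\,G^4t_{\mathrm{hit}}t_{\mathrm{mix}}^2(\log T)^{3/2}}{\mu^2}+\frac{\sqrt A\,(BG+G^3)\,t_{\mathrm{mix}}\log T}{\mu^2}\Big)\sqrt T .$$ -/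

import Mathlib

open scoped RealInnerProductSpace
open MeasureTheory

namespace AvgRewardPG

noncomputable section

/-- A finite Markov decision process `(S, A, r, P, ρ)` with rewards in `[0, 1]`;
`P s a s'` is the probability of moving to `s'` from `s` under the action `a`. -/
structure MDP (S A : Type*) [Fintype S] [Fintype A] where
  r : S → A → ℝ
  P : S → A → S → ℝ
  ρ : S → ℝ
  r_mem : ∀ s a, r s a ∈ Set.Icc (0 : ℝ) 1
  P_mem : ∀ s a, P s a ∈ stdSimplex ℝ S
  ρ_mem : ρ ∈ stdSimplex ℝ S

/-- `π s a` is the probability of choosing the action `a` in the state `s`. -/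
def IsPolicy {S A : Type*} [Fintype A] (π : S → A → ℝ) : Prop :=
  ∀ s, π s ∈ stdSimplex ℝ A

/-- The parameter space `Θ = ℝ^d` with the Euclidean norm. -/
abbrev Param (d : ℕ) := EuclideanSpace ℝ (Fin d)

/-- A trajectory `(s_t, a_t)`, indexed from its first time step on. -/
abbrev Traj (S A : Type*) := ℕ → S × A

section MarkovChain

variable {S A : Type*} [Fintype S] [DecidableEq S] [Fintype A] [DecidableEq A]

/-- `P^π(s, s') = ∑ₐ P(s' | s, a) π(a | s)`. -/
def MDP.trans (M : MDP S A) (π : S → A → ℝ) : Matrix S S ℝ :=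
  Matrix.of fun s s' => ∑ a, M.P s a s' * π s a

/-- `r^π(s) = ∑ₐ r(s, a) π(a | s)`. -/
def MDP.rew (M : MDP S A) (π : S → A → ℝ) : S → ℝ :=
  fun s => ∑ a, M.r s a * π s a

/-- The Markov chain induced by every policy is irreducible and aperiodic (the return times of
every state have greatest common divisor one). -/
def MDP.Ergodic (M : MDP S A) : Prop :=
  ∀ π : S → A → ℝ, IsPolicy π →
    (∀ s s', ∃ n : ℕ, 0 < (M.trans π ^ n) s s') ∧
    (∀ s, ∀ k : ℕ, (∀ n : ℕ, 0 < (M.trans π ^ n) s s → k ∣ n) → k = 1)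

/-- The stationary distribution `d^π` (it exists and is unique for an ergodic MDP). -/
def MDP.stat (M : MDP S A) (π : S → A → ℝ) : S → ℝ :=
  Classical.epsilon fun δ : S → ℝ => δ ∈ stdSimplex ℝ S ∧ Matrix.vecMul δ (M.trans π) = δ

/-- `𝔼_π[r(s_t, a_t) | s_0 = s]`. -/
def MDP.rewAt (M : MDP S A) (π : S → A → ℝ) (t : ℕ) (s : S) : ℝ :=
  Matrix.mulVec (M.trans π ^ t) (M.rew π) s

/-- `𝔼_π[r(s_t, a_t) | s_0 = s, a_0 = a]`. -/
def MDP.rewAtQ (M : MDP S A) (π : S → A → ℝ) : ℕ → S → A → ℝ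
  | 0, s, a => M.r s a
  | t + 1, s, a => ∑ s', M.P s a s' * M.rewAt π t s'

/-- The long-term average reward
`J^π = lim_{T → ∞} (1 / T) 𝔼_π[∑_{t < T} r(s_t, a_t) | s_0 ∼ ρ]`. -/
def MDP.J (M : MDP S A) (π : S → A → ℝ) : ℝ :=
  Filter.limUnder Filter.atTop fun T : ℕ =>
    (1 / (T : ℝ)) * ∑ t ∈ Finset.range T, ∑ s, M.ρ s * M.rewAt π t s

/-- The state value function `V^π`. -/
def MDP.V (M : MDP S A) (π : S → A → ℝ) (s : S) : ℝ :=
  ∑' t : ℕ, (M.rewAt π t s - M.J π)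

/-- The state-action value function `Q^π`. -/
def MDP.Q (M : MDP S A) (π : S → A → ℝ) (s : S) (a : A) : ℝ :=
  ∑' t : ℕ, (M.rewAtQ π t s a - M.J π)

/-- The advantage function `A^π`. -/
def MDP.adv (M : MDP S A) (π : S → A → ℝ) (s : S) (a : A) : ℝ :=
  M.Q π s a - M.V π s

/-- `π` maximizes the average reward among all policies. -/
def MDP.IsOptimal (M : MDP S A) (π : S → A → ℝ) : Prop :=
  IsPolicy π ∧ ∀ π' : S → A → ℝ, IsPolicy π' → M.J π' ≤ M.J π

/-- The mixing time of one policy: the least `t ≥ 1` with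
`‖(P^π)^t(s, ·) - d^π‖₁ ≤ 1/4` for all `s`. -/
def MDP.tmixOf (M : MDP S A) (π : S → A → ℝ) : ℕ :=
  sInf {t : ℕ | 1 ≤ t ∧ ∀ s, ∑ s', |(M.trans π ^ t) s s' - M.stat π s'| ≤ 1 / 4}

/-- The hitting time of one policy, `max_s 1 / d^π(s)`. -/
def MDP.thitOf (M : MDP S A) (π : S → A → ℝ) : ℝ :=
  ⨆ s, 1 / M.stat π s

/-- The mixing time of the policy class. -/
def MDP.tmix (M : MDP S A) {d : ℕ} (π : Param d → S → A → ℝ) : ℕ :=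
  ⨆ θ, M.tmixOf (π θ)

/-- The hitting time of the policy class. -/
def MDP.thit (M : MDP S A) {d : ℕ} (π : Param d → S → A → ℝ) : ℝ :=
  ⨆ θ, M.thitOf (π θ)

end MarkovChain

section Assumptions

variable {S A : Type*} [Fintype S] [DecidableEq S] [Fintype A] [DecidableEq A] {d : ℕ}

/-- `θ ↦ log π_θ(a | s)`. -/
def logPol (π : Param d → S → A → ℝ) (s : S) (a : A) : Param d → ℝ :=
  fun θ => Real.log (π θ s a)

/-- The score function `∇_θ log π_θ(a | s)`. -/
def score (π : Param d → S → A → ℝ) (θ : Param d) (s : S) (a : A) : Param d :=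
  gradient (logPol π s a) θ

/-- The Hessian of `f` at `θ`, as an operator on `ℝ^d`. -/
def hessian (f : Param d → ℝ) (θ : Param d) : Param d →L[ℝ] Param d :=
  fderiv ℝ (gradient f) θ

/-- A class of policies with positive action probabilities, so that `log π_θ(a | s)` makes
sense. -/
def IsPolicyClass (π : Param d → S → A → ℝ) : Prop :=
  ∀ θ, IsPolicy (π θ) ∧ ∀ s a, 0 < π θ s a

/-- The log-probabilities are twice differentiable, with score bounded by `G` and Hessian
bounded by `B` in operator norm. -/
def ScoreBounds (π : Param d → S → A → ℝ) (G B : ℝ) : Prop :=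
  ∀ s a, Differentiable ℝ (logPol π s a) ∧ Differentiable ℝ (gradient (logPol π s a)) ∧
    ∀ θ, ‖score π θ s a‖ ≤ G ∧ ‖hessian (logPol π s a) θ‖ ≤ B

/-- `𝔼_{s ∼ δ, a ∼ κ(· | s)} [(∇_θ log π_θ(a | s) · ω - A^{π_θ}(s, a))²]`. -/
def MDP.approxErr (M : MDP S A) (π : Param d → S → A → ℝ) (δ : S → ℝ) (κ : S → A → ℝ)
    (θ ω : Param d) : ℝ :=
  ∑ s, δ s * ∑ a, κ s a * (⟪score π θ s a, ω⟫ - M.adv (π θ) s a) ^ 2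

/-- `ω` is the natural policy gradient direction `ω*_θ` at `θ`: it minimizes the compatible
function approximation error under `s ∼ d^{π_θ}`, `a ∼ π_θ(· | s)`. -/
def MDP.IsNPGDirection (M : MDP S A) (π : Param d → S → A → ℝ) (θ ω : Param d) : Prop :=
  ∀ ω' : Param d,
    M.approxErr π (M.stat (π θ)) (π θ) θ ω ≤ M.approxErr π (M.stat (π θ)) (π θ) θ ω'

/-- The transferred function approximation error is at most `ε` at every parameter. -/
def MDP.TransferErrorLe (M : MDP S A) (π : Param d → S → A → ℝ) (πstar : S → A → ℝ)
    (ε : ℝ) : Prop :=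
  ∀ θ ω : Param d, M.IsNPGDirection π θ ω → M.approxErr π (M.stat πstar) πstar θ ω ≤ ε

/-- The Fisher information matrix
`F(θ) = 𝔼_{s ∼ d^{π_θ}, a ∼ π_θ(· | s)} [∇_θ log π_θ(a | s) (∇_θ log π_θ(a | s))ᵀ]`. -/
def MDP.fisher (M : MDP S A) (π : Param d → S → A → ℝ) (θ : Param d) :
    Matrix (Fin d) (Fin d) ℝ :=
  Matrix.of fun i j =>
    ∑ s, M.stat (π θ) s * ∑ a, π θ s a * (score π θ s a i * score π θ s a j)

/-- `F(θ) - μ I` is positive semidefinite for every `θ`. -/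
def MDP.FisherNondegenerate (M : MDP S A) (π : Param d → S → A → ℝ) (μ : ℝ) : Prop :=
  ∀ θ, (M.fisher π θ - μ • (1 : Matrix (Fin d) (Fin d) ℝ)).PosSemidef

end Assumptions

section Estimators

variable {S A : Type*} [Fintype S] [DecidableEq S] [Fintype A] [DecidableEq A] {d : ℕ}

/-- The loop that scans a trajectory of length `len` from time `ξ` on for visits to `s`: after a
visit it jumps ahead by `2 N`, otherwise by one, and it stops when fewer than `N` further steps
are left. The first argument bounds the number of iterations; `len` iterations are enough when
`N ≥ 1`. -/
def visitsFrom (τ : Traj S A) (len N : ℕ) (s : S) : ℕ → ℕ → List ℕ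
  | 0, _ => []
  | fuel + 1, ξ =>
    if ξ + N ≤ len - 1 then
      if (τ ξ).1 = s then ξ :: visitsFrom τ len N s fuel (ξ + 2 * N)
      else visitsFrom τ len N s fuel (ξ + 1)
    else []

/-- The starting times `ξ_1, …, ξ_i` of the sub-trajectories that start in `s`. -/
def visits (τ : Traj S A) (len N : ℕ) (s : S) : List ℕ :=
  visitsFrom τ len N s len 0

/-- The reward collected by the sub-trajectory of length `N` that starts at time `ξ`. -/
def MDP.subReward (M : MDP S A) (τ : Traj S A) (N ξ : ℕ) : ℝ :=
  ∑ t ∈ Finset.range N, M.r (τ (ξ + t)).1 (τ (ξ + t)).2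

/-- The estimate `V̂(τ, s)`; it is zero if there is no visit to `s`. -/
def MDP.Vhat (M : MDP S A) (τ : Traj S A) (len N : ℕ) (s : S) : ℝ :=
  ((visits τ len N s).map fun ξ => M.subReward τ N ξ).sum / (visits τ len N s).length

/-- `(1 / i) ∑_j y_j 1(a_{ξ_j} = a)`, which is `Q̂(τ, s, a) π_θ(a | s)` and does not depend on
the policy. -/
def MDP.QhatNum (M : MDP S A) (τ : Traj S A) (len N : ℕ) (s : S) (a : A) : ℝ :=
  ((visits τ len N s).map fun ξ => if (τ ξ).2 = a then M.subReward τ N ξ else 0).sum /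
    (visits τ len N s).length

/-- The estimate `Q̂(τ, s, a)` under the policy `κ`. -/
def MDP.Qhat (M : MDP S A) (κ : S → A → ℝ) (τ : Traj S A) (len N : ℕ) (s : S) (a : A) : ℝ :=
  M.QhatNum τ len N s a / κ s a

/-- The advantage estimate `Â(τ, s, a)` under the policy `κ`. -/
def MDP.Ahat (M : MDP S A) (κ : S → A → ℝ) (τ : Traj S A) (len N : ℕ) (s : S) (a : A) : ℝ :=
  M.Qhat κ τ len N s a - M.Vhat τ len N s

/-- The gradient estimate `g(θ, τ)` from a trajectory of length `len`. -/
def MDP.gradEst (M : MDP S A) (π : Param d → S → A → ℝ) (len N : ℕ) (θ : Param d)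
    (τ : Traj S A) : Param d :=
  (1 / ((len : ℝ) - N)) • ∑ t ∈ Finset.Ico N len,
    M.Ahat (π θ) τ len N (τ t).1 (τ t).2 • score π θ (τ t).1 (τ t).2

/-- The function `Φ(θ, τ)`. -/
def MDP.Phi (M : MDP S A) (π : Param d → S → A → ℝ) (len N : ℕ) (τ : Traj S A)
    (θ : Param d) : ℝ :=
  (1 / ((len : ℝ) - N)) * ∑ t ∈ Finset.Ico N len,
    (-M.Vhat τ len N (τ t).1 * Real.log (π θ (τ t).1 (τ t).2) +
      -M.QhatNum τ len N (τ t).1 (τ t).2 / π θ (τ t).1 (τ t).2)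

/-- `∇_θ log p(τ, θ, ρ̄)`, where `p(τ, θ, ρ̄)` is the probability of the trajectory `τ` of length
`len` under `π_θ`: the initial distribution and the transition probabilities do not depend on
`θ`, so only the scores remain. -/
def gradLogProb (π : Param d → S → A → ℝ) (len : ℕ) (θ : Param d) (τ : Traj S A) : Param d :=
  ∑ t ∈ Finset.range len, score π θ (τ t).1 (τ t).2

/-- The Hessian estimate `B(θ, τ) = ∇Φ(θ, τ) (∇ log p(τ, θ, ρ̄))ᵀ + ∇²Φ(θ, τ)`, applied to the
vector `u`. -/
def MDP.hessEst (M : MDP S A) (π : Param d → S → A → ℝ) (len N : ℕ) (θ : Param d)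
    (τ : Traj S A) (u : Param d) : Param d :=
  ⟪gradLogProb π len θ τ, u⟫ • gradient (M.Phi π len N τ) θ +
    hessian (M.Phi π len N τ) θ u

end Estimators

section Algorithm

variable {S A : Type*} [Fintype S] [DecidableEq S] [Fintype A] [DecidableEq A] {d : ℕ}

/-- The input of the algorithm: the initial parameters `θ_0, θ_1`, the step sizes `γ_k`, the
momentum parameters `η_k`, half of the epoch length `H = 2 · half`, and the window `N`. -/
structure Input (d : ℕ) where
  θ₀ : Param d
  θ₁ : Param d
  γ : ℕ → ℝ
  η : ℕ → ℝ
  half : ℕ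
  N : ℕ

/-- The memory `(θ_{k-1}, θ_k, d_{k-1})` at the start of epoch `k`. -/
structure Memory (d : ℕ) where
  prev : Param d
  cur : Param d
  dir : Param d

/-- `θ̂_k = q_k θ_k + (1 - q_k) θ_{k-1}`. -/
def Memory.mid (m : Memory d) (q : ℝ) : Param d :=
  q • m.cur + (1 - q) • m.prev

/-- The new direction `d_k = (1 - η_k) (d_{k-1} + v(θ̂_k, τ̂_k)) + η_k g(θ_k, τ_k)`, with
`v(θ̂_k, τ̂_k) = B(θ̂_k, τ̂_k) (θ_k - θ_{k-1})`. -/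
def MDP.direction (M : MDP S A) (π : Param d → S → A → ℝ) (I : Input d) (k : ℕ) (q : ℝ)
    (τ τhat : Traj S A) (m : Memory d) : Param d :=
  (1 - I.η k) • (m.dir + M.hessEst π I.half I.N (m.mid q) τhat (m.cur - m.prev)) +
    I.η k • M.gradEst π I.half I.N m.cur τ

/-- The memory at the start of epoch `k + 1`, given the uniform random numbers `q` and the
trajectory `x` of the whole run. Epoch `k ≥ 1` occupies the times
`(k - 1) H, …, k H - 1`; its first half is `τ_k` and its second half is `τ̂_k`. The update is
`θ_{k+1} = θ_k + γ_k d_k / ‖d_k‖`, read as `θ_{k+1} = θ_k` if `d_k = 0`. -/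
def MDP.memory (M : MDP S A) (π : Param d → S → A → ℝ) (I : Input d)
    (q : ℕ → unitInterval) (x : Traj S A) : ℕ → Memory d
  | 0 => ⟨I.θ₀, I.θ₁, 0⟩
  | k + 1 =>
    let m := M.memory π I q x k
    let dk := M.direction π I (k + 1) (q (k + 1))
      (fun i => x (k * (2 * I.half) + i)) (fun i => x (k * (2 * I.half) + I.half + i)) m
    ⟨m.cur, m.cur + (I.γ (k + 1) / ‖dk‖) • dk, dk⟩

/-- The parameter of the policy that is executed at time `t`: `θ_k` in the first half and `θ̂_k`
in the second half of epoch `k`, where `k = t / H + 1`. -/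
def MDP.paramAt (M : MDP S A) (π : Param d → S → A → ℝ) (I : Input d)
    (q : ℕ → unitInterval) (x : Traj S A) (t : ℕ) : Param d :=
  let m := M.memory π I q x (t / (2 * I.half))
  if t % (2 * I.half) < I.half then m.cur else m.mid (q (t / (2 * I.half) + 1))

/-- A trajectory of length `T` as a sequence; the values from time `T` on are never used. -/
def extend [Nonempty S] [Nonempty A] {T : ℕ} (x : Fin T → S × A) : Traj S A :=
  fun t => if h : t < T then x ⟨t, h⟩ else Classical.arbitrary (S × A)

/-- The conditional probability, given the uniform random numbers `q`, that the first `T`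
state-action pairs of the run of the algorithm are those of `x`:
`s_0 ∼ ρ`, `a_t ∼ π_{paramAt t}(· | s_t)` and `s_{t+1} ∼ P(· | s_t, a_t)`. -/
def MDP.runProb (M : MDP S A) (π : Param d → S → A → ℝ) (I : Input d) (T : ℕ)
    (q : ℕ → unitInterval) (x : Traj S A) : ℝ :=
  ∏ t ∈ Finset.range T,
    ((if t = 0 then M.ρ (x 0).1 else M.P (x (t - 1)).1 (x (t - 1)).2 (x t).1) *
      π (M.paramAt π I q x t) (x t).1 (x t).2)

/-- `Reg_T = ∑_{t < T} (J* - r(s_t, a_t))`. -/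
def MDP.regret (M : MDP S A) (Jstar : ℝ) (T : ℕ) (x : Traj S A) : ℝ :=
  ∑ t ∈ Finset.range T, (Jstar - M.r (x t).1 (x t).2)

/-- The conditional expectation of the regret given the uniform random numbers `q`. -/
def MDP.condRegret [Nonempty S] [Nonempty A] (M : MDP S A) (π : Param d → S → A → ℝ)
    (I : Input d) (Jstar : ℝ) (T : ℕ) (q : ℕ → unitInterval) : ℝ :=
  ∑ x : Fin T → S × A, M.runProb π I T q (extend x) * M.regret Jstar T (extend x)

/-- The law of the independent uniform random numbers `q_1, q_2, …` on `[0, 1]`. -/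
def uniformLaw : Measure (ℕ → unitInterval) :=
  Measure.infinitePi fun _ => (volume : Measure unitInterval)

/-- The expected regret `𝔼[Reg_T]` of the algorithm. -/
def MDP.expRegret [Nonempty S] [Nonempty A] (M : MDP S A) (π : Param d → S → A → ℝ)
    (I : Input d) (Jstar : ℝ) (T : ℕ) : ℝ :=
  ∫ q, M.condRegret π I Jstar T q ∂uniformLaw

/-- The input used in the regret bound: `γ_k = 6 G / (μ (k + 2))`, `η_k = 2 / (k + 2)`,
`H = 63 t_mix t_hit (log₂ T)²` rounded up to an even integer, and `N = 7 t_mix log₂ T` rounded up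
to an integer. -/
def MDP.input (M : MDP S A) (π : Param d → S → A → ℝ) (G μ : ℝ) (T : ℕ) (θ₀ θ₁ : Param d) :
    Input d where
  θ₀ := θ₀
  θ₁ := θ₁
  γ k := 6 * G / (μ * ((k : ℝ) + 2))
  η k := 2 / ((k : ℝ) + 2)
  half := ⌈63 * (M.tmix π : ℝ) * M.thit π * Real.logb 2 T ^ 2 / 2⌉₊
  N := ⌈7 * (M.tmix π : ℝ) * Real.logb 2 T⌉₊

end Algorithm

end

end AvgRewardPG

open AvgRewardPG

/-! The bound needs no analysis of the estimators: under the nondegeneracy assumption every policy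
of the class is already optimal up to `√ε`, so the direction in which the algorithm moves is
irrelevant and only the length of its steps counts.

Near-optimality (`J_sub_le_sqrt`). The performance difference lemma, the transfer error and the
Fisher bound give gradient domination, `J* - J(θ) ≤ √ε + (G/μ) ‖∇J(θ)‖`, at every `θ`
(`J_sub_le_grad`). But `J` is bounded on all of `ℝ^d`, so minimizing `J` plus a small quadratic
penalty centred at a given `θ` yields a point `θ'` with `J(θ') ≤ J(θ)` and arbitrarily small
gradient (`exists_small_grad`). Domination at `θ'` then gives `J* - J(θ) ≤ J* - J(θ') ≤ √ε` in the
limit.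

Tracking (`runExp_sum_J_sub_r_le`). What remains is the expected sum of `J(π_t) - r(s_t, a_t)` over
the executed policies `π_t`. By the Poisson equation this sum telescopes for a fixed policy, up to
the size of the value function, which is of order `t_mix`. Each change of policy costs the resulting
change of the normalized value function, which is at most `11 t_mix²` times the `ℓ¹` distance of the
policies (`abs_V_sub_V_le`).

Path length (`pathBound_le`). Updates are normalized, so epoch `k` moves the policy by at most a
multiple of `G² / (μ (k + 2))`, and these sum to at most a multiple of `(G² / μ) √T`. The excess is
thus of order `t_mix² (G² / μ) √T`. Since `μ ≤ G²` and `t_hit`, `√A` are at least one, the second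
term of the claimed bound alone absorbs it; the other two are nonnegative. -/

open Matrix Finset Filter Topology

namespace AvgRewardPG

set_option linter.unusedSectionVars false

/-! ### Contraction, stationary distributions and mixing of finite stochastic matrices -/

section StochasticMatrix

variable {S : Type*} [Fintype S]

/-- The `ℓ¹` norm of a vector. -/
noncomputable def l1 (v : S → ℝ) : ℝ := ∑ s, |v s|

lemma l1_nonneg (v : S → ℝ) : 0 ≤ l1 v := sum_nonneg fun _ _ => abs_nonneg _

lemma l1_add_le (v w : S → ℝ) : l1 (v + w) ≤ l1 v + l1 w := by
  simp only [l1, ← sum_add_distrib]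
  exact sum_le_sum fun s _ => abs_add_le _ _

lemma l1_sub_le (v w : S → ℝ) : l1 (v - w) ≤ l1 v + l1 w := by
  simp only [l1, ← sum_add_distrib]
  exact sum_le_sum fun s _ => abs_sub _ _

lemma l1_of_mem_stdSimplex {v : S → ℝ} (hv : v ∈ stdSimplex ℝ S) : l1 v = 1 := by
  rw [← hv.2]
  exact sum_congr rfl fun s _ => abs_of_nonneg (hv.1 s)

lemma abs_dotProduct_le {v f : S → ℝ} {c : ℝ} (hf : ∀ s, |f s| ≤ c) : |v ⬝ᵥ f| ≤ l1 v * c := by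
  rw [l1, sum_mul]
  refine (abs_sum_le_sum_abs _ _).trans (sum_le_sum fun s _ => ?_)
  rw [abs_mul]
  exact mul_le_mul_of_nonneg_left (hf s) (abs_nonneg _)

/-- A vector of total mass zero is shrunk by a matrix whose rows are close to a common row. -/
lemma l1_vecMul_le {Q : Matrix S S ℝ} {δ v : S → ℝ} {c : ℝ} (hQ : ∀ s, l1 (Q s - δ) ≤ c)
    (hv : ∑ s, v s = 0) : l1 (v ᵥ* Q) ≤ c * l1 v := by
  have h : ∀ s', (v ᵥ* Q) s' = ∑ s, v s * (Q s s' - δ s') := by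
    intro s'
    simp only [mul_sub, sum_sub_distrib, ← sum_mul, hv, zero_mul, sub_zero]
    rfl
  calc l1 (v ᵥ* Q) ≤ ∑ s', ∑ s, |v s| * |Q s s' - δ s'| := by
        refine sum_le_sum fun s' _ => ?_
        rw [h]
        refine (abs_sum_le_sum_abs _ _).trans (le_of_eq ?_)
        simp [abs_mul]
    _ = ∑ s, |v s| * l1 (Q s - δ) := by
        rw [sum_comm]
        simp [l1, mul_sum]
    _ ≤ ∑ s, |v s| * c := sum_le_sum fun s _ => mul_le_mul_of_nonneg_left (hQ s) (abs_nonneg _)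
    _ = c * l1 v := by rw [← sum_mul, mul_comm]; rfl

variable [DecidableEq S]

lemma sum_vecMul_of_rowStochastic {P : Matrix S S ℝ} (hP : P ∈ rowStochastic ℝ S) (v : S → ℝ) :
    ∑ s, (v ᵥ* P) s = ∑ s, v s := by
  simp only [vecMul, dotProduct]
  rw [sum_comm]
  simp [← mul_sum, sum_row_of_mem_rowStochastic hP]

lemma l1_vecMul_le_of_rowStochastic {P : Matrix S S ℝ} (hP : P ∈ rowStochastic ℝ S)
    (v : S → ℝ) : l1 (v ᵥ* P) ≤ l1 v := by
  calc l1 (v ᵥ* P) ≤ ∑ s', ∑ s, |v s| * P s s' := by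
        refine sum_le_sum fun s' _ => (abs_sum_le_sum_abs _ _).trans (le_of_eq ?_)
        exact sum_congr rfl fun s _ => by
          rw [abs_mul, abs_of_nonneg (nonneg_of_mem_rowStochastic hP)]
    _ = l1 v := by
        rw [sum_comm]
        simp [← mul_sum, sum_row_of_mem_rowStochastic hP, l1]

lemma mem_stdSimplex_row {P : Matrix S S ℝ} (hP : P ∈ rowStochastic ℝ S) (s : S) :
    P s ∈ stdSimplex ℝ S :=
  ⟨fun _ => nonneg_of_mem_rowStochastic hP, sum_row_of_mem_rowStochastic hP s⟩

/-- If the chain mixes in `t` steps, a vector of total mass zero has summable orbit. -/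
lemma sum_l1_vecMul_pow_le {P : Matrix S S ℝ} (hP : P ∈ rowStochastic ℝ S) {δ : S → ℝ} {t : ℕ}
    (hmix : ∀ s, l1 ((P ^ t) s - δ) ≤ 1 / 4) {v : S → ℝ} (hv : ∑ s, v s = 0) (L : ℕ) :
    ∑ n ∈ range L, l1 (v ᵥ* P ^ n) ≤ 4 / 3 * t * l1 v := by
  have hone : ∀ n, l1 (v ᵥ* P ^ n) ≤ l1 v := fun n =>
    l1_vecMul_le_of_rowStochastic (pow_mem hP n) v
  have hshift : ∀ n, l1 (v ᵥ* P ^ (t + n)) ≤ 1 / 4 * l1 (v ᵥ* P ^ n) := by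
    intro n
    rw [add_comm, pow_add, ← vecMul_vecMul]
    exact l1_vecMul_le hmix ((sum_vecMul_of_rowStochastic (pow_mem hP n) v).trans hv)
  -- Let `X` be the sum over `range L`. The first `t` terms contribute at most `t * l1 v` and every
  -- later term is a quarter of the one `t` steps earlier, so `X ≤ t * l1 v + X / 4`.
  have h1 : ∑ n ∈ range L, l1 (v ᵥ* P ^ n) ≤ ∑ n ∈ range (t + L), l1 (v ᵥ* P ^ n) :=
    sum_le_sum_of_subset_of_nonneg (range_mono (by lia)) fun _ _ _ => l1_nonneg _
  rw [sum_range_add] at h1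
  have h2 : ∑ n ∈ range t, l1 (v ᵥ* P ^ n) ≤ t * l1 v := by
    simpa using sum_le_sum fun n (_ : n ∈ range t) => hone n
  have h3 : ∑ n ∈ range L, l1 (v ᵥ* P ^ (t + n)) ≤ 1 / 4 * ∑ n ∈ range L, l1 (v ᵥ* P ^ n) := by
    rw [mul_sum]
    exact sum_le_sum fun n _ => hshift n
  linarith

lemma summable_l1_vecMul_pow {P : Matrix S S ℝ} (hP : P ∈ rowStochastic ℝ S) {δ : S → ℝ} {t : ℕ}
    (hmix : ∀ s, l1 ((P ^ t) s - δ) ≤ 1 / 4) {v : S → ℝ} (hv : ∑ s, v s = 0) :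
    Summable fun n => l1 (v ᵥ* P ^ n) :=
  summable_of_sum_range_le (fun _ => l1_nonneg _) fun L => sum_l1_vecMul_pow_le hP hmix hv L

/-- A finite Markov chain has a stationary distribution. -/
lemma exists_stationary [Nonempty S] {P : Matrix S S ℝ} (hP : P ∈ rowStochastic ℝ S) :
    ∃ δ : S → ℝ, δ ∈ stdSimplex ℝ S ∧ δ ᵥ* P = δ := by
  -- The constant vector is a right null vector of `P - 1`, so a left null vector exists as well;
  -- its absolute value, normalized, will be the stationary distribution.
  have hdet : (P - 1).det = 0 := by
    rw [← exists_mulVec_eq_zero_iff]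
    refine ⟨1, one_ne_zero, ?_⟩
    rw [sub_mulVec, one_mulVec, one_vecMul_of_mem_rowStochastic hP, sub_self]
  obtain ⟨v, hv0, hv⟩ := exists_vecMul_eq_zero_iff.2 hdet
  rw [vecMul_sub, vecMul_one, sub_eq_zero] at hv
  -- Entrywise `|v| ≤ |v| P`, while both sides have the same total mass, so equality holds in every
  -- entry.
  have hle : ∀ s ∈ univ, |v s| ≤ ((fun s => |v s|) ᵥ* P) s := by
    intro s _
    conv_lhs => rw [← hv]
    refine (abs_sum_le_sum_abs _ _).trans (le_of_eq ?_)
    exact sum_congr rfl fun s _ => by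
      rw [abs_mul, abs_of_nonneg (nonneg_of_mem_rowStochastic hP)]
  have heq := (sum_eq_sum_iff_of_le hle).1 (sum_vecMul_of_rowStochastic hP _).symm
  have hpos : 0 < l1 v := by
    obtain ⟨s, hs⟩ := Function.ne_iff.1 hv0
    exact sum_pos' (fun _ _ => abs_nonneg _) ⟨s, mem_univ _, abs_pos.2 hs⟩
  refine ⟨(l1 v)⁻¹ • fun s => |v s|, ⟨fun s => ?_, ?_⟩, ?_⟩
  · exact mul_nonneg (inv_nonneg.2 hpos.le) (abs_nonneg _)
  · simp only [Pi.smul_apply, smul_eq_mul, ← mul_sum]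
    exact inv_mul_cancel₀ hpos.ne'
  · rw [smul_vecMul]
    congr 1
    exact funext fun s => (heq s (mem_univ _)).symm

lemma vecMul_pow_of_stationary {P : Matrix S S ℝ} {δ : S → ℝ} (hδ : δ ᵥ* P = δ) (n : ℕ) :
    δ ᵥ* P ^ n = δ := by
  induction n with
  | zero => simp
  | succ n ih => rw [pow_succ, ← vecMul_vecMul, ih, hδ]

/-- A chain whose `m`-step transition probabilities are bounded below mixes. -/
lemma l1_row_sub_stationary_le {P : Matrix S S ℝ} (hP : P ∈ rowStochastic ℝ S) {δ : S → ℝ}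
    (hδ : δ ∈ stdSimplex ℝ S) (hst : δ ᵥ* P = δ) {m : ℕ} {c : ℝ}
    (hc : ∀ s s', c ≤ (P ^ m) s s') (hc0 : 0 ≤ c) (n : ℕ) (s : S) :
    l1 ((P ^ (m * n)) s - δ) ≤ 2 * (1 - c) ^ n := by
  -- Every row of `P ^ m` dominates the constant vector `c`, so its distance to that common vector
  -- is exactly the remaining mass `1 - |S| c`. The common vector need not be stationary for
  -- `l1_vecMul_le`.
  have hrow : ∀ s, l1 ((P ^ m) s - fun _ => c) ≤ 1 - c := by
    intro s
    have h : l1 ((P ^ m) s - fun _ => c) = 1 - Fintype.card S * c := by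
      rw [← sum_row_of_mem_rowStochastic (pow_mem hP m) s]
      calc l1 ((P ^ m) s - fun _ => c) = ∑ s', ((P ^ m) s s' - c) :=
            sum_congr rfl fun s' _ => abs_of_nonneg (sub_nonneg.2 (hc s s'))
        _ = _ := by simp [sum_sub_distrib]
    rw [h]
    have : (1 : ℝ) ≤ Fintype.card S := by
      exact_mod_cast Fintype.card_pos_iff.2 ⟨s⟩
    nlinarith
  have hc1 : 0 ≤ 1 - c := (l1_nonneg _).trans (hrow s)
  have key : ∀ v : S → ℝ, ∑ s, v s = 0 → l1 (v ᵥ* P ^ (m * n)) ≤ l1 v * (1 - c) ^ n := by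
    intro v hv
    induction n with
    | zero => simp
    | succ n ih =>
      rw [mul_add, mul_one, pow_add, ← vecMul_vecMul]
      refine (l1_vecMul_le hrow
        ((sum_vecMul_of_rowStochastic (pow_mem hP _) v).trans hv)).trans ?_
      calc (1 - c) * l1 (v ᵥ* P ^ (m * n)) ≤ (1 - c) * (l1 v * (1 - c) ^ n) :=
            mul_le_mul_of_nonneg_left ih hc1
        _ = _ := by ring
  have hv : (P ^ (m * n)) s - δ = (Pi.single s 1 - δ) ᵥ* P ^ (m * n) := by
    rw [sub_vecMul, vecMul_pow_of_stationary hst, single_one_vecMul]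
    rfl
  have hs : Pi.single s (1 : ℝ) ∈ stdSimplex ℝ S := single_mem_stdSimplex ℝ s
  rw [hv]
  refine (key _ ?_).trans (mul_le_mul_of_nonneg_right ?_ (pow_nonneg hc1 n))
  · simp [sum_sub_distrib, hδ.2]
  · refine (l1_sub_le _ _).trans (le_of_eq ?_)
    rw [l1_of_mem_stdSimplex hs, l1_of_mem_stdSimplex hδ]
    norm_num

lemma pow_add_pos {P : Matrix S S ℝ} (hP : P ∈ rowStochastic ℝ S) {m n : ℕ} {s s' s'' : S}
    (h : 0 < (P ^ m) s s') (h' : 0 < (P ^ n) s' s'') : 0 < (P ^ (m + n)) s s'' := by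
  rw [pow_add, mul_apply]
  exact sum_pos' (fun i _ => mul_nonneg (nonneg_of_mem_rowStochastic (pow_mem hP m))
    (nonneg_of_mem_rowStochastic (pow_mem hP n))) ⟨s', mem_univ _, mul_pos h h'⟩

/-- The powers of an irreducible aperiodic stochastic matrix are eventually positive. -/
lemma exists_pow_pos {P : Matrix S S ℝ} (hP : P ∈ rowStochastic ℝ S)
    (hirr : ∀ s s', ∃ n : ℕ, 0 < (P ^ n) s s')
    (haper : ∀ s, ∀ k : ℕ, (∀ n : ℕ, 0 < (P ^ n) s s → k ∣ n) → k = 1) :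
    ∃ m, ∀ n ≥ m, ∀ s s', 0 < (P ^ n) s s' := by
  have hret : ∀ s, ∃ m, ∀ n ≥ m, 0 < (P ^ n) s s := by
    intro s
    -- The return times to `s` form an additive monoid whose gcd is one, and such a monoid contains
    -- all large integers.
    let R : AddSubmonoid ℕ :=
      { carrier := {n | 0 < (P ^ n) s s}
        zero_mem' := by simp
        add_mem' := fun ha hb => pow_add_pos hP ha hb }
    have hgcd : Nat.setGcd (R : Set ℕ) = 1 :=
      haper s _ fun n hn => Nat.setGcd_dvd_of_mem (s := (R : Set ℕ)) hn
    obtain ⟨m, hm⟩ := Nat.exists_mem_closure_of_ge (R : Set ℕ)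
    refine ⟨m, fun n hn => ?_⟩
    have := hm n hn (by simp [hgcd])
    rwa [AddSubmonoid.closure_eq] at this
  choose m hm using hret
  choose k hk using hirr
  refine ⟨∑ s, m s + ∑ s, ∑ s', k s s', fun n hn s s' => ?_⟩
  have h1 : m s ≤ ∑ s, m s := single_le_sum (fun _ _ => Nat.zero_le _) (mem_univ s)
  have h2 : k s s' ≤ ∑ s', k s s' :=
    single_le_sum (f := fun s' => k s s') (fun _ _ => Nat.zero_le _) (mem_univ s')
  have h3 : ∑ s', k s s' ≤ ∑ s, ∑ s', k s s' :=
    single_le_sum (f := fun s => ∑ s', k s s') (fun _ _ => Nat.zero_le _) (mem_univ s)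
  have := pow_add_pos hP (hm s (n - k s s') (by lia)) (hk s s')
  rwa [Nat.sub_add_cancel (by lia)] at this

/-- The stationary distribution depends on the transition matrix in a Lipschitz way. -/
lemma l1_stationary_sub_le {P P' : Matrix S S ℝ} (hP : P ∈ rowStochastic ℝ S)
    {δ δ' : S → ℝ} {t : ℕ} (hmix : ∀ s, l1 ((P ^ t) s - δ) ≤ 1 / 4)
    (hδ : δ ∈ stdSimplex ℝ S) (hδ' : δ' ∈ stdSimplex ℝ S)
    (hst : δ ᵥ* P = δ) (hst' : δ' ᵥ* P' = δ') :
    l1 (δ' - δ) ≤ 4 / 3 * t * l1 (δ' ᵥ* (P' - P)) := by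
  set v := δ' - δ with hvdef
  set w := δ' ᵥ* (P' - P) with hw
  have hv0 : ∑ s, v s = 0 := by simp [hvdef, sum_sub_distrib, hδ.2, hδ'.2]
  -- Iterating this identity `t` times and using the contraction gives `l1 v ≤ l1 v / 4 + t * l1 w`,
  -- whence the factor `4/3`.
  have hstep : v = v ᵥ* P + w := by
    rw [hw, hvdef, vecMul_sub, sub_vecMul, hst, hst']
    abel
  have hit : ∀ n : ℕ, l1 v ≤ l1 (v ᵥ* P ^ n) + n * l1 w := by
    intro n
    induction n with
    | zero => simp
    | succ n ih =>
      have h : v ᵥ* P ^ n = v ᵥ* P ^ (n + 1) + w ᵥ* P ^ n := by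
        conv_lhs => rw [hstep, add_vecMul, vecMul_vecMul, ← pow_succ']
      have h1 := l1_add_le (v ᵥ* P ^ (n + 1)) (w ᵥ* P ^ n)
      have h2 := l1_vecMul_le_of_rowStochastic (pow_mem hP n) w
      rw [← h] at h1
      push_cast
      linarith
  have := hit t
  have := l1_vecMul_le hmix hv0
  linarith

end StochasticMatrix

/-! ### Uniform mixing over policies, the Poisson equation and Lipschitz dependence on the policy -/

section Values

variable {S A : Type*} [Fintype S] [DecidableEq S] [Fintype A] {M : MDP S A}

lemma trans_mem (M : MDP S A) {κ : S → A → ℝ} (hκ : IsPolicy κ) :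
    M.trans κ ∈ rowStochastic ℝ S := by
  rw [mem_rowStochastic_iff_sum]
  refine ⟨fun s s' => sum_nonneg fun a _ => mul_nonneg ((M.P_mem s a).1 s') ((hκ s).1 a),
    fun s => ?_⟩
  simp only [MDP.trans, of_apply]
  rw [sum_comm]
  simp [← sum_mul, (M.P_mem s _).2, (hκ s).2]

lemma isCompact_policies : IsCompact {κ : S → A → ℝ | IsPolicy κ} := by
  have : {κ : S → A → ℝ | IsPolicy κ} = Set.pi Set.univ fun _ => stdSimplex ℝ A := by
    ext κ
    simp [IsPolicy]
  rw [this]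
  exact isCompact_univ_pi fun _ => isCompact_stdSimplex ℝ A

lemma continuous_trans_pow (M : MDP S A) (n : ℕ) (s s' : S) :
    Continuous fun κ : S → A → ℝ => (M.trans κ ^ n) s s' := by
  have h : Continuous fun κ : S → A → ℝ => M.trans κ := by
    refine continuous_matrix fun i j => ?_
    simp only [MDP.trans, of_apply]
    fun_prop
  exact (h.pow n).matrix_elem s s'

/-- In an ergodic MDP the transition probabilities over some fixed number of steps are bounded
below, uniformly over all policies. -/
lemma exists_uniform_minorization (hM : M.Ergodic) :
    ∃ (m : ℕ) (c : ℝ), 0 < c ∧ ∀ κ, IsPolicy κ → ∀ s s', c ≤ (M.trans κ ^ m) s s' := by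
  have hpos : ∀ κ, IsPolicy κ → ∃ m, ∀ n ≥ m, ∀ s s', 0 < (M.trans κ ^ n) s s' := fun κ hκ =>
    exists_pow_pos (trans_mem M hκ) (hM κ hκ).1 (hM κ hκ).2
  choose! k hk using hpos
  -- Compactness is used twice: the sets `U m` give one exponent that makes all entries positive for
  -- all policies, then the sets `W n` give one positive lower bound for these entries.
  let U : ℕ → Set (S → A → ℝ) := fun m => {κ | ∀ s s', 0 < (M.trans κ ^ m) s s'}
  have hU : ∀ m, IsOpen (U m) := fun m => by
    simp only [U, Set.ofPred_forall]
    exact isOpen_iInter_of_finite fun s => isOpen_iInter_of_finite fun s' =>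
      isOpen_lt continuous_const (continuous_trans_pow M m s s')
  have hcov : {κ : S → A → ℝ | IsPolicy κ} ⊆ ⋃ m, U m := fun κ hκ =>
    Set.mem_iUnion.2 ⟨k κ, hk κ hκ _ le_rfl⟩
  obtain ⟨F, hF⟩ := isCompact_policies.elim_finite_subcover U hU hcov
  -- Positivity persists at larger exponents, since the first step of the chain goes somewhere with
  -- positive probability. The sum of a finite set of exponents can then replace each of them.
  have hmono : ∀ κ, IsPolicy κ → ∀ m n, κ ∈ U m → κ ∈ U (m + n) := by
    intro κ hκ m n h
    induction n with
    | zero => exact h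
    | succ n ih =>
      intro s s'
      have hP := trans_mem M hκ
      obtain ⟨s'', hs''⟩ : ∃ s'', 0 < M.trans κ s s'' := by
        by_contra! hcon
        have := sum_nonpos fun s'' (_ : s'' ∈ univ) => hcon s''
        rw [sum_row_of_mem_rowStochastic hP] at this
        linarith
      have := pow_add_pos hP (m := 1) (by simpa using hs'') (ih s'' s')
      rwa [show 1 + (m + n) = m + (n + 1) by ring] at this
  let m := ∑ i ∈ F, i
  have hm : ∀ κ, IsPolicy κ → κ ∈ U m := by
    intro κ hκ
    obtain ⟨i, hiF, hi⟩ := Set.mem_iUnion₂.1 (hF hκ)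
    have hle : i ≤ m := single_le_sum (f := fun i => i) (fun _ _ => Nat.zero_le _) hiF
    have := hmono κ hκ i (m - i) hi
    rwa [Nat.add_sub_cancel' hle] at this
  let W : ℕ → Set (S → A → ℝ) := fun n => {κ | ∀ s s', 1 / ((n : ℝ) + 1) < (M.trans κ ^ m) s s'}
  have hW : ∀ n, IsOpen (W n) := fun n => by
    simp only [W, Set.ofPred_forall]
    exact isOpen_iInter_of_finite fun s => isOpen_iInter_of_finite fun s' =>
      isOpen_lt continuous_const (continuous_trans_pow M m s s')
  have hcovW : {κ : S → A → ℝ | IsPolicy κ} ⊆ ⋃ n, W n := by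
    intro κ hκ
    have : ∀ᶠ n : ℕ in atTop, ∀ s s', 1 / ((n : ℝ) + 1) < (M.trans κ ^ m) s s' := by
      rw [eventually_all]
      intro s
      rw [eventually_all]
      exact fun s' => tendsto_one_div_add_atTop_nhds_zero_nat.eventually
        (gt_mem_nhds (hm κ hκ s s'))
    obtain ⟨n, hn⟩ := this.exists
    exact Set.mem_iUnion.2 ⟨n, hn⟩
  have hdir : Directed (· ⊆ ·) W := directed_of_isDirected_le fun i j hij κ hκ s s' =>
    (one_div_le_one_div_of_le (by positivity) (by gcongr)).trans_lt (hκ s s')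
  obtain ⟨n, hn⟩ := isCompact_policies.elim_directed_cover W hW hcovW hdir
  exact ⟨m, 1 / ((n : ℝ) + 1), by positivity, fun κ hκ s s' => (hn hκ s s').le⟩

variable [Nonempty S]

lemma stat_spec (M : MDP S A) {κ : S → A → ℝ} (hκ : IsPolicy κ) :
    M.stat κ ∈ stdSimplex ℝ S ∧ M.stat κ ᵥ* M.trans κ = M.stat κ :=
  Classical.epsilon_spec (exists_stationary (trans_mem M hκ))

/-- Uniform minorization forces geometric mixing at a rate independent of the policy. This makes the
supremum defining `tmix` a genuine one; an unbounded supremum in `ℕ` would be the default value `0`.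
-/
lemma exists_uniform_mixing (hM : M.Ergodic) :
    ∃ t : ℕ, 1 ≤ t ∧ ∀ κ, IsPolicy κ → ∀ s, l1 ((M.trans κ ^ t) s - M.stat κ) ≤ 1 / 4 := by
  obtain ⟨m, c, hc, h⟩ := exists_uniform_minorization hM
  have hm : ∀ c' : ℝ, 0 < c' → c' ≤ c → c' < 1 →
      ∃ t : ℕ, 1 ≤ t ∧ ∀ κ, IsPolicy κ → ∀ s, l1 ((M.trans κ ^ t) s - M.stat κ) ≤ 1 / 4 := by
    intro c' hc' hcc' h1
    obtain ⟨n, hn⟩ := exists_pow_lt_of_lt_one (show (0 : ℝ) < 1 / 8 by norm_num)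
      (show 1 - c' < 1 by linarith)
    -- The extra step guarantees `1 ≤ t` and cannot increase the distance to stationarity.
    refine ⟨m * n + 1, by lia, fun κ hκ s => ?_⟩
    have hP := trans_mem M hκ
    have hs := stat_spec M hκ
    have hrow : (M.trans κ ^ (m * n + 1)) s - M.stat κ =
        ((M.trans κ ^ (m * n)) s - M.stat κ) ᵥ* M.trans κ := by
      rw [sub_vecMul, hs.2, pow_succ]
      rfl
    rw [hrow]
    refine (l1_vecMul_le_of_rowStochastic hP _).trans ?_
    have := l1_row_sub_stationary_le hP hs.1 hs.2 (fun s s' => hcc'.trans (h κ hκ s s')) hc'.le n s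
    linarith
  exact hm (min c (1 / 2)) (by positivity) (min_le_left _ _)
    ((min_le_right _ _).trans_lt (by norm_num))

lemma tmixOf_spec (hM : M.Ergodic) {κ : S → A → ℝ} (hκ : IsPolicy κ) :
    1 ≤ M.tmixOf κ ∧ ∀ s, l1 ((M.trans κ ^ M.tmixOf κ) s - M.stat κ) ≤ 1 / 4 := by
  obtain ⟨t, ht, h⟩ := exists_uniform_mixing hM
  exact Nat.sInf_mem (s := {t : ℕ | 1 ≤ t ∧ ∀ s, ∑ s', |(M.trans κ ^ t) s s' - M.stat κ s'| ≤
    1 / 4}) ⟨t, ht, h κ hκ⟩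

/-- Stochastic matrices do not increase the `ℓ¹` norm. This lets the single time `tmix` serve all
policies of the class. -/
lemma mixing_mono {κ : S → A → ℝ} (hκ : IsPolicy κ) {t t' : ℕ} (htt' : t ≤ t')
    (h : ∀ s, l1 ((M.trans κ ^ t) s - M.stat κ) ≤ 1 / 4) (s : S) :
    l1 ((M.trans κ ^ t') s - M.stat κ) ≤ 1 / 4 := by
  obtain ⟨n, rfl⟩ := Nat.exists_eq_add_of_le htt'
  have hrow : (M.trans κ ^ (t + n)) s - M.stat κ =
      ((M.trans κ ^ t) s - M.stat κ) ᵥ* M.trans κ ^ n := by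
    rw [sub_vecMul, vecMul_pow_of_stationary (stat_spec M hκ).2, pow_add]
    rfl
  rw [hrow]
  exact (l1_vecMul_le_of_rowStochastic (pow_mem (trans_mem M hκ) n) _).trans (h s)

lemma bddAbove_tmixOf (hM : M.Ergodic) {d : ℕ} {π : Param d → S → A → ℝ}
    (hπ : ∀ θ, IsPolicy (π θ)) : BddAbove (Set.range fun θ => M.tmixOf (π θ)) := by
  obtain ⟨t, ht, h⟩ := exists_uniform_mixing hM
  refine ⟨t, ?_⟩
  rintro _ ⟨θ, rfl⟩
  exact Nat.sInf_le ⟨ht, h _ (hπ θ)⟩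

lemma tmix_spec (hM : M.Ergodic) {d : ℕ} {π : Param d → S → A → ℝ}
    (hπ : ∀ θ, IsPolicy (π θ)) :
    1 ≤ M.tmix π ∧ ∀ θ s, l1 ((M.trans (π θ) ^ M.tmix π) s - M.stat (π θ)) ≤ 1 / 4 := by
  have hle : ∀ θ, M.tmixOf (π θ) ≤ M.tmix π := le_ciSup (bddAbove_tmixOf hM hπ)
  exact ⟨(tmixOf_spec hM (hπ 0)).1.trans (hle 0), fun θ =>
    mixing_mono (hπ θ) (hle θ) (tmixOf_spec hM (hπ θ)).2⟩

/-- The minorization bounds all stationary probabilities below by `c`, so the real suprema defining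
`thit` are over bounded sets and do not take the default value `0`; each `1 / d^π(s)` is at least
one. -/
lemma one_le_thit (hM : M.Ergodic) {d : ℕ} {π : Param d → S → A → ℝ}
    (hπ : ∀ θ, IsPolicy (π θ)) : 1 ≤ M.thit π := by
  obtain ⟨m, c, hc, h⟩ := exists_uniform_minorization hM
  have hlow : ∀ θ s, c ≤ M.stat (π θ) s := by
    intro θ s
    have hs := stat_spec M (hπ θ)
    rw [← vecMul_pow_of_stationary hs.2 m]
    calc c = ∑ s', M.stat (π θ) s' * c := by rw [← sum_mul, hs.1.2, one_mul]
      _ ≤ _ := sum_le_sum fun s' _ => mul_le_mul_of_nonneg_left (h _ (hπ θ) s' s) (hs.1.1 s')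
  have hup : ∀ θ, M.thitOf (π θ) ≤ 1 / c := fun θ =>
    ciSup_le fun s => one_div_le_one_div_of_le hc (hlow θ s)
  have hone : 1 ≤ M.thitOf (π 0) := by
    obtain ⟨s⟩ := ‹Nonempty S›
    have hs := (stat_spec M (hπ 0)).1
    refine le_trans ?_ (le_ciSup (Set.finite_range _).bddAbove s)
    rw [le_div_iff₀ (hc.trans_le (hlow 0 s)), one_mul, ← hs.2]
    exact single_le_sum (fun s _ => hs.1 s) (mem_univ s)
  exact hone.trans (le_ciSup (f := fun θ => M.thitOf (π θ))
    ⟨1 / c, by rintro _ ⟨θ, rfl⟩; exact hup θ⟩ 0)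

lemma rew_mem (M : MDP S A) {κ : S → A → ℝ} (hκ : IsPolicy κ) (s : S) :
    0 ≤ M.rew κ s ∧ M.rew κ s ≤ 1 := by
  refine ⟨sum_nonneg fun a _ => mul_nonneg (M.r_mem s a).1 ((hκ s).1 a), ?_⟩
  rw [← (hκ s).2]
  exact sum_le_sum fun a _ => mul_le_of_le_one_left ((hκ s).1 a) (M.r_mem s a).2

lemma abs_rew_le (M : MDP S A) {κ : S → A → ℝ} (hκ : IsPolicy κ) (s : S) :
    |M.rew κ s| ≤ 1 := by
  rw [abs_of_nonneg (rew_mem M hκ s).1]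
  exact (rew_mem M hκ s).2

/-- Subtracting the stationary reward replaces the starting point mass by a vector of total mass
zero, whose orbit is summable. -/
lemma rewAt_sub_eq (M : MDP S A) {κ : S → A → ℝ} (hκ : IsPolicy κ) (t : ℕ) (s : S) :
    M.rewAt κ t s - M.stat κ ⬝ᵥ M.rew κ =
      ((Pi.single s 1 - M.stat κ) ᵥ* M.trans κ ^ t) ⬝ᵥ M.rew κ := by
  rw [sub_vecMul, vecMul_pow_of_stationary (stat_spec M hκ).2, single_one_vecMul, sub_dotProduct]
  rfl

lemma abs_rewAt_sub_le (M : MDP S A) {κ : S → A → ℝ} (hκ : IsPolicy κ) (t : ℕ) (s : S) :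
    |M.rewAt κ t s - M.stat κ ⬝ᵥ M.rew κ| ≤
      l1 ((Pi.single s 1 - M.stat κ) ᵥ* M.trans κ ^ t) := by
  rw [rewAt_sub_eq M hκ]
  simpa using abs_dotProduct_le
    (v := (Pi.single s 1 - M.stat κ) ᵥ* M.trans κ ^ t) (abs_rew_le M hκ)

lemma sum_single_sub_stat (M : MDP S A) {κ : S → A → ℝ} (hκ : IsPolicy κ) (s : S) :
    ∑ s', (Pi.single s 1 - M.stat κ : S → ℝ) s' = 0 := by
  simp [sum_sub_distrib, (stat_spec M hκ).1.2]

lemma summable_rewAt_sub (hM : M.Ergodic) {κ : S → A → ℝ} (hκ : IsPolicy κ) (s : S) :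
    Summable fun t => M.rewAt κ t s - M.stat κ ⬝ᵥ M.rew κ :=
  Summable.of_norm_bounded (summable_l1_vecMul_pow (trans_mem M hκ) (tmixOf_spec hM hκ).2
    (sum_single_sub_stat M hκ s)) fun t => abs_rewAt_sub_le M hκ t s

/-- The average reward is the expected reward under the stationary distribution. -/
lemma J_eq (hM : M.Ergodic) {κ : S → A → ℝ} (hκ : IsPolicy κ) :
    M.J κ = M.stat κ ⬝ᵥ M.rew κ := by
  have h : Tendsto (fun t => ∑ s, M.ρ s * M.rewAt κ t s) atTop
      (𝓝 (∑ s, M.ρ s * (M.stat κ ⬝ᵥ M.rew κ))) := by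
    refine tendsto_finsetSum _ fun s _ => Tendsto.const_mul _ ?_
    simpa using (summable_rewAt_sub hM hκ s).tendsto_atTop_zero.add_const
      (M.stat κ ⬝ᵥ M.rew κ)
  rw [← sum_mul, M.ρ_mem.2, one_mul] at h
  refine Tendsto.limUnder_eq ?_
  simpa only [one_div] using h.cesaro

lemma J_mem (hM : M.Ergodic) {κ : S → A → ℝ} (hκ : IsPolicy κ) : 0 ≤ M.J κ ∧ M.J κ ≤ 1 := by
  rw [J_eq hM hκ]
  have hs := (stat_spec M hκ).1
  refine ⟨sum_nonneg fun s _ => mul_nonneg (hs.1 s) (rew_mem M hκ s).1, ?_⟩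
  rw [← hs.2]
  exact sum_le_sum fun s _ => mul_le_of_le_one_right (hs.1 s) (rew_mem M hκ s).2

lemma summable_V (hM : M.Ergodic) {κ : S → A → ℝ} (hκ : IsPolicy κ) (s : S) :
    Summable fun t => M.rewAt κ t s - M.J κ := by
  rw [J_eq hM hκ]
  exact summable_rewAt_sub hM hκ s

/-- The value function is bounded by a multiple of the mixing time. -/
lemma abs_V_le (hM : M.Ergodic) {κ : S → A → ℝ} (hκ : IsPolicy κ) {t : ℕ}
    (hmix : ∀ s, l1 ((M.trans κ ^ t) s - M.stat κ) ≤ 1 / 4) (s : S) :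
    |M.V κ s| ≤ 8 / 3 * t := by
  have hsum := summable_l1_vecMul_pow (trans_mem M hκ) hmix (sum_single_sub_stat M hκ s)
  have h := tsum_of_norm_bounded (f := fun n => M.rewAt κ n s - M.J κ) hsum.hasSum fun n => by
    rw [J_eq hM hκ]
    exact abs_rewAt_sub_le M hκ n s
  refine le_trans h ?_
  refine hsum.tsum_le_of_sum_range_le fun L => ?_
  refine (sum_l1_vecMul_pow_le (trans_mem M hκ) hmix (sum_single_sub_stat M hκ s) L).trans ?_
  have : l1 (Pi.single s 1 - M.stat κ) ≤ 2 := by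
    refine (l1_sub_le _ _).trans (le_of_eq ?_)
    rw [l1_of_mem_stdSimplex (single_mem_stdSimplex ℝ s),
      l1_of_mem_stdSimplex (stat_spec M hκ).1]
    norm_num
  nlinarith [(Nat.cast_nonneg t : (0 : ℝ) ≤ t)]

lemma Q_eq (hM : M.Ergodic) {κ : S → A → ℝ} (hκ : IsPolicy κ) (s : S) (a : A) :
    M.Q κ s a = M.r s a - M.J κ + ∑ s', M.P s a s' * M.V κ s' := by
  have hs : HasSum (fun t => M.rewAtQ κ (t + 1) s a - M.J κ) (∑ s', M.P s a s' * M.V κ s') := by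
    have h := hasSum_sum fun s' (_ : s' ∈ univ) =>
      (summable_V hM hκ s').hasSum.mul_left (M.P s a s')
    refine h.congr_fun fun t => ?_
    simp [MDP.rewAtQ, mul_sub, sum_sub_distrib, ← sum_mul, (M.P_mem s a).2]
  have h := (hasSum_nat_add_iff (f := fun t => M.rewAtQ κ t s a - M.J κ) 1).1 hs
  rw [MDP.Q, h.tsum_eq]
  simp [MDP.rewAtQ, add_comm]

lemma rewAt_succ (M : MDP S A) (κ : S → A → ℝ) (t : ℕ) (s : S) :
    M.rewAt κ (t + 1) s = ∑ s', M.trans κ s s' * M.rewAt κ t s' := by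
  simp only [MDP.rewAt, pow_succ', ← mulVec_mulVec]
  rfl

/-- Averages over actions of one-step expectations are expectations under the transition matrix. -/
lemma sum_policy_mul_next (M : MDP S A) (κ : S → A → ℝ) (f : S → ℝ) (s : S) :
    ∑ a, κ s a * ∑ s', M.P s a s' * f s' = ∑ s', M.trans κ s s' * f s' := by
  simp only [MDP.trans, of_apply, mul_sum, sum_mul]
  rw [sum_comm]
  exact sum_congr rfl fun s' _ => sum_congr rfl fun a _ => by ring

/-- The Poisson equation. -/
lemma V_eq (hM : M.Ergodic) {κ : S → A → ℝ} (hκ : IsPolicy κ) (s : S) :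
    M.V κ s = M.rew κ s - M.J κ + ∑ s', M.trans κ s s' * M.V κ s' := by
  have hs : HasSum (fun t => M.rewAt κ (t + 1) s - M.J κ) (∑ s', M.trans κ s s' * M.V κ s') := by
    have h := hasSum_sum fun s' (_ : s' ∈ univ) =>
      (summable_V hM hκ s').hasSum.mul_left (M.trans κ s s')
    refine h.congr_fun fun t => ?_
    simp [rewAt_succ, mul_sub, sum_sub_distrib, ← sum_mul,
      sum_row_of_mem_rowStochastic (trans_mem M hκ)]
  have h := (hasSum_nat_add_iff (f := fun t => M.rewAt κ t s - M.J κ) 1).1 hs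
  rw [MDP.V, h.tsum_eq]
  simp [MDP.rewAt, add_comm]

lemma sum_policy_mul_Q (hM : M.Ergodic) {κ κ' : S → A → ℝ} (hκ : IsPolicy κ)
    (hκ' : IsPolicy κ') (s : S) :
    ∑ a, κ' s a * M.Q κ s a =
      M.rew κ' s - M.J κ + ∑ s', M.trans κ' s s' * M.V κ s' := by
  rw [← sum_policy_mul_next]
  simp only [Q_eq hM hκ, mul_add, mul_sub, sum_add_distrib, sum_sub_distrib, ← sum_mul,
    (hκ' s).2, one_mul, MDP.rew, mul_comm (M.r s _)]

lemma sum_policy_mul_adv (hM : M.Ergodic) {κ : S → A → ℝ} (hκ : IsPolicy κ) (s : S) :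
    ∑ a, κ s a * M.adv κ s a = 0 := by
  simp only [MDP.adv, mul_sub, sum_sub_distrib, ← sum_mul, (hκ s).2, one_mul]
  rw [sum_policy_mul_Q hM hκ hκ, ← V_eq hM hκ, sub_self]

/-- The performance difference lemma. -/
lemma J_sub_J (hM : M.Ergodic) {κ κ' : S → A → ℝ} (hκ : IsPolicy κ) (hκ' : IsPolicy κ') :
    M.J κ' - M.J κ = ∑ s, M.stat κ' s * ∑ a, κ' s a * M.adv κ s a := by
  have hs := stat_spec M hκ'
  have h1 : ∀ s, ∑ a, κ' s a * M.adv κ s a =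
      M.rew κ' s - M.J κ + ∑ s', M.trans κ' s s' * M.V κ s' - M.V κ s := by
    intro s
    simp only [MDP.adv, mul_sub, sum_sub_distrib, ← sum_mul, (hκ' s).2, one_mul]
    rw [sum_policy_mul_Q hM hκ hκ']
  -- Stationarity of `M.stat κ'` under its own chain makes the values of `κ` before and after a step
  -- cancel.
  have h2 : ∑ s, M.stat κ' s * ∑ s', M.trans κ' s s' * M.V κ s' =
      ∑ s, M.stat κ' s * M.V κ s := by
    have := dotProduct_mulVec (M.stat κ') (M.trans κ') (M.V κ)
    rw [hs.2] at this
    exact this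
  simp only [h1, mul_sub, mul_add, sum_sub_distrib, sum_add_distrib, h2, ← sum_mul, hs.1.2]
  rw [J_eq hM hκ']
  simp [dotProduct]

/-- The value function normalized at a reference state depends on the policy in a Lipschitz
way. -/
lemma abs_V_sub_V_le (hM : M.Ergodic) {κ κ' : S → A → ℝ} (hκ : IsPolicy κ) (hκ' : IsPolicy κ')
    {t : ℕ} (ht : 1 ≤ t) (hmix : ∀ s, l1 ((M.trans κ ^ t) s - M.stat κ) ≤ 1 / 4)
    (hmix' : ∀ s, l1 ((M.trans κ' ^ t) s - M.stat κ') ≤ 1 / 4) {Δ : ℝ}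
    (hΔ : ∀ s, l1 (κ' s - κ s) ≤ Δ) (s s₀ : S) :
    |(M.V κ' s - M.V κ' s₀) - (M.V κ s - M.V κ s₀)| ≤ 11 * (t : ℝ) ^ 2 * Δ := by
  have ht' : (1 : ℝ) ≤ t := by exact_mod_cast ht
  set W : S → ℝ := M.V κ' - M.V κ with hW
  let h : S → ℝ := fun s => ∑ a, (κ' s a - κ s a) * (M.r s a + ∑ s', M.P s a s' * M.V κ s')
  set v : S → ℝ := Pi.single s 1 - Pi.single s₀ 1 with hv
  have hP' := trans_mem M hκ'
  have hv0 : ∑ s, v s = 0 := by simp [hv, sum_sub_distrib]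
  have hvl : l1 v ≤ 2 := by
    refine (l1_sub_le _ _).trans (le_of_eq ?_)
    rw [l1_of_mem_stdSimplex (single_mem_stdSimplex ℝ s),
      l1_of_mem_stdSimplex (single_mem_stdSimplex ℝ s₀)]
    norm_num
  have hΔ0 : 0 ≤ Δ := (l1_nonneg _).trans (hΔ s)
  have hh : ∀ s, |h s| ≤ 4 * t * Δ := by
    intro s
    have hb : ∀ a, |M.r s a + ∑ s', M.P s a s' * M.V κ s'| ≤ 4 * t := by
      intro a
      have h1 : |M.r s a| ≤ 1 := by
        rw [abs_of_nonneg (M.r_mem s a).1]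
        exact (M.r_mem s a).2
      have h2 : |M.P s a ⬝ᵥ M.V κ| ≤ l1 (M.P s a) * (8 / 3 * t) :=
        abs_dotProduct_le (abs_V_le hM hκ hmix)
      rw [l1_of_mem_stdSimplex (M.P_mem s a), one_mul] at h2
      refine (abs_add_le _ _).trans ?_
      change |M.r s a| + |M.P s a ⬝ᵥ M.V κ| ≤ _
      linarith
    have := abs_dotProduct_le (v := κ' s - κ s) hb
    refine this.trans ?_
    have := hΔ s
    nlinarith
  -- The difference of the two Poisson equations is again a Poisson equation for the chain of `κ'`,
  -- with source `h`. Its unknown constant disappears against vectors of total mass zero such as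
  -- `v`, which is why values are compared with a reference state.
  have hstep : W = h - (fun _ => M.J κ' - M.J κ) + M.trans κ' *ᵥ W := by
    funext s
    have e1 := V_eq hM hκ' s
    have e2 := V_eq hM hκ s
    have e3 : h s = M.rew κ' s - M.rew κ s +
        (∑ s', M.trans κ' s s' * M.V κ s' - ∑ s', M.trans κ s s' * M.V κ s') := by
      simp only [h, sub_mul, mul_add, sum_sub_distrib, sum_add_distrib, sum_policy_mul_next,
        MDP.rew, mul_comm (M.r s _)]
    have e4 : (M.trans κ' *ᵥ W) s =
        ∑ s', M.trans κ' s s' * M.V κ' s' - ∑ s', M.trans κ' s s' * M.V κ s' := by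
      simp [hW, mulVec, dotProduct, mul_sub, sum_sub_distrib]
    simp only [Pi.add_apply, Pi.sub_apply, e4, e3]
    simp only [hW, Pi.sub_apply]
    linarith
  have hstep' : ∀ u : S → ℝ, ∑ s, u s = 0 → u ⬝ᵥ W = u ⬝ᵥ h + (u ᵥ* M.trans κ') ⬝ᵥ W := by
    intro u hu
    conv_lhs => rw [hstep]
    rw [dotProduct_add, dotProduct_sub, dotProduct_mulVec]
    simp [dotProduct, ← sum_mul, hu]
  have hiter : ∀ L : ℕ, |v ⬝ᵥ W| ≤ (∑ n ∈ range L, l1 (v ᵥ* M.trans κ' ^ n)) * (4 * t * Δ) +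
      l1 (v ᵥ* M.trans κ' ^ L) * (16 / 3 * t) := by
    have hWb : ∀ s, |W s| ≤ 16 / 3 * t := by
      intro s
      have := abs_V_le hM hκ hmix s
      have := abs_V_le hM hκ' hmix' s
      refine (abs_sub _ _).trans ?_
      linarith
    have hexp : ∀ L : ℕ, v ⬝ᵥ W = ∑ n ∈ range L, (v ᵥ* M.trans κ' ^ n) ⬝ᵥ h +
        (v ᵥ* M.trans κ' ^ L) ⬝ᵥ W := by
      intro L
      induction L with
      | zero => simp
      | succ L ih =>
        rw [ih, sum_range_succ, hstep' _ ((sum_vecMul_of_rowStochastic (pow_mem hP' L) v).trans hv0),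
          vecMul_vecMul, ← pow_succ, add_assoc]
    intro L
    rw [hexp L]
    refine (abs_add_le _ _).trans (add_le_add ?_ (abs_dotProduct_le hWb))
    rw [sum_mul]
    exact (abs_sum_le_sum_abs _ _).trans (sum_le_sum fun n _ => abs_dotProduct_le hh)
  have hlim := (summable_l1_vecMul_pow hP' hmix' hv0).tendsto_atTop_zero.mul_const (16 / 3 * (t : ℝ))
  have hbound : ∀ L : ℕ, |v ⬝ᵥ W| ≤ 11 * (t : ℝ) ^ 2 * Δ +
      l1 (v ᵥ* M.trans κ' ^ L) * (16 / 3 * t) := by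
    intro L
    refine (hiter L).trans (add_le_add_left ?_ _)
    have hs := sum_l1_vecMul_pow_le hP' hmix' hv0 L
    have hs' : ∑ n ∈ range L, l1 (v ᵥ* M.trans κ' ^ n) ≤ 8 / 3 * t := by nlinarith
    -- The constant `11` rounds up `8/3 * 4 = 32/3`.
    calc _ ≤ 8 / 3 * t * (4 * t * Δ) := mul_le_mul_of_nonneg_right hs' (by positivity)
      _ ≤ _ := by nlinarith [mul_nonneg (sq_nonneg (t : ℝ)) hΔ0]
  have hfin := ge_of_tendsto' (hlim.const_add (11 * (t : ℝ) ^ 2 * Δ)) hbound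
  have hvW : v ⬝ᵥ W = (M.V κ' s - M.V κ' s₀) - (M.V κ s - M.V κ s₀) := by
    simp only [hv, hW, sub_dotProduct, single_one_dotProduct, Pi.sub_apply]
    ring
  rw [hvW] at hfin
  simpa using hfin

/-- The stationary distribution depends on the policy in a Lipschitz way. -/
lemma l1_stat_sub_stat_le {κ κ' : S → A → ℝ} (hκ : IsPolicy κ) (hκ' : IsPolicy κ')
    {t : ℕ} (hmix : ∀ s, l1 ((M.trans κ ^ t) s - M.stat κ) ≤ 1 / 4) {Δ : ℝ}
    (hΔ : ∀ s, l1 (κ' s - κ s) ≤ Δ) : l1 (M.stat κ' - M.stat κ) ≤ 4 / 3 * t * Δ := by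
  have hs := stat_spec M hκ
  have hs' := stat_spec M hκ'
  refine (l1_stationary_sub_le (trans_mem M hκ) hmix hs.1 hs'.1 hs.2 hs'.2).trans ?_
  refine mul_le_mul_of_nonneg_left ?_ (by positivity)
  have hrow : ∀ s, l1 ((M.trans κ' - M.trans κ) s) ≤ Δ := by
    intro s
    refine le_trans ?_ (hΔ s)
    calc l1 ((M.trans κ' - M.trans κ) s) ≤ ∑ s', ∑ a, M.P s a s' * |κ' s a - κ s a| := by
          refine sum_le_sum fun s' _ => ?_
          have : (M.trans κ' - M.trans κ) s s' = ∑ a, M.P s a s' * (κ' s a - κ s a) := by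
            simp [MDP.trans, mul_sub, sum_sub_distrib]
          rw [this]
          refine (abs_sum_le_sum_abs _ _).trans (le_of_eq ?_)
          exact sum_congr rfl fun a _ => by rw [abs_mul, abs_of_nonneg ((M.P_mem s a).1 s')]
      _ = l1 (κ' s - κ s) := by
          rw [sum_comm]
          simp [← sum_mul, (M.P_mem s _).2, l1]
  calc l1 (M.stat κ' ᵥ* (M.trans κ' - M.trans κ))
      ≤ ∑ s', ∑ s, M.stat κ' s * |(M.trans κ' - M.trans κ) s s'| := by
        refine sum_le_sum fun s' _ => (abs_sum_le_sum_abs _ _).trans (le_of_eq ?_)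
        exact sum_congr rfl fun s _ => by rw [abs_mul, abs_of_nonneg (hs'.1.1 s)]
    _ = ∑ s, M.stat κ' s * l1 ((M.trans κ' - M.trans κ) s) := by
        rw [sum_comm]
        simp [← mul_sum, l1]
    _ ≤ ∑ s, M.stat κ' s * Δ :=
        sum_le_sum fun s _ => mul_le_mul_of_nonneg_left (hrow s) (hs'.1.1 s)
    _ = Δ := by rw [← sum_mul, hs'.1.2, one_mul]

end Values

/-! ### Policy gradient, gradient domination and near-optimality of the whole class -/

section PolicyClass

variable {S A : Type*} [Fintype S] [DecidableEq S] [Fintype A] {M : MDP S A}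
  {d : ℕ} {π : Param d → S → A → ℝ} {G B μ : ℝ}

lemma hasFDerivAt_policy (hπ : IsPolicyClass π) (hb : ScoreBounds π G B) (θ : Param d) (s : S)
    (a : A) : HasFDerivAt (fun θ => π θ s a)
      (π θ s a • InnerProductSpace.toDual ℝ (Param d) (score π θ s a)) θ := by
  have h := ((hb s a).1 θ).hasGradientAt.hasFDerivAt.exp
  have he : ∀ θ, Real.exp (logPol π s a θ) = π θ s a := fun θ => Real.exp_log ((hπ θ).2 s a)
  simp only [he] at h
  exact h

lemma continuous_policy (hπ : IsPolicyClass π) (hb : ScoreBounds π G B) (s : S) (a : A) :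
    Continuous fun θ => π θ s a :=
  continuous_iff_continuousAt.2 fun θ => (hasFDerivAt_policy hπ hb θ s a).continuousAt

lemma scoreBounds_nonneg [Nonempty S] [Nonempty A] (hb : ScoreBounds π G B) : 0 ≤ G ∧ 0 ≤ B := by
  obtain ⟨s⟩ := ‹Nonempty S›
  obtain ⟨a⟩ := ‹Nonempty A›
  have := (hb s a).2.2 0
  exact ⟨(norm_nonneg _).trans this.1, (norm_nonneg _).trans this.2⟩

/-- The action probabilities are Lipschitz in `ℓ¹`, with the bound on the score as constant. -/
lemma l1_policy_sub_le (hπ : IsPolicyClass π) (hb : ScoreBounds π G B) (θ θ' : Param d) (s : S) :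
    l1 (π θ' s - π θ s) ≤ G * ‖θ' - θ‖ := by
  -- With the signs frozen at the two endpoints, the `ℓ¹` distance is an increment of the smooth
  -- function `f`, to which the mean value inequality applies.
  let σ : A → ℝ := fun a => SignType.sign (π θ' s a - π θ s a)
  let f : Param d → ℝ := fun ϑ => ∑ a, σ a * π ϑ s a
  have hσ : ∀ a, |σ a| ≤ 1 := by
    intro a
    simp only [σ]
    rcases SignType.sign (π θ' s a - π θ s a) <;> simp
  have hf : ∀ ϑ, HasFDerivAt f (∑ a, σ a • (π ϑ s a •
      InnerProductSpace.toDual ℝ (Param d) (score π ϑ s a))) ϑ := fun ϑ =>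
    HasFDerivAt.fun_sum fun a _ => (hasFDerivAt_policy hπ hb ϑ s a).const_mul (σ a)
  have hf' : ∀ ϑ, ‖∑ a, σ a • (π ϑ s a •
      InnerProductSpace.toDual ℝ (Param d) (score π ϑ s a))‖ ≤ G := by
    intro ϑ
    calc _ ≤ ∑ a, π ϑ s a * G := by
          refine (norm_sum_le _ _).trans (sum_le_sum fun a _ => ?_)
          have hp := (hπ ϑ).2 s a
          rw [norm_smul, norm_smul, Real.norm_eq_abs, Real.norm_eq_abs, abs_of_pos hp,
            LinearIsometryEquiv.norm_map]
          have h1 := ((hb s a).2.2 ϑ).1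
          calc |σ a| * (π ϑ s a * ‖score π ϑ s a‖) ≤ 1 * (π ϑ s a * ‖score π ϑ s a‖) :=
                mul_le_mul_of_nonneg_right (hσ a) (by positivity)
            _ ≤ π ϑ s a * G := by rw [one_mul]; gcongr
      _ = G := by rw [← sum_mul, ((hπ ϑ).1 s).2, one_mul]
  have hmv := Convex.norm_image_sub_le_of_norm_hasFDerivWithin_le (s := Set.univ)
    (fun x _ => (hf x).hasFDerivWithinAt) (fun x _ => hf' x) convex_univ (Set.mem_univ θ)
    (Set.mem_univ θ')
  have heq : f θ' - f θ = l1 (π θ' s - π θ s) := by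
    simp only [f, ← sum_sub_distrib, ← mul_sub, l1, Pi.sub_apply, σ]
    exact sum_congr rfl fun a _ => sign_mul_self _
  rw [heq] at hmv
  exact (le_abs_self _).trans hmv

lemma l1_policy_sub_le_two (hπ : IsPolicyClass π) (θ θ' : Param d) (s : S) :
    l1 (π θ' s - π θ s) ≤ 2 := by
  refine (l1_sub_le _ _).trans (le_of_eq ?_)
  rw [l1_of_mem_stdSimplex ((hπ θ').1 s), l1_of_mem_stdSimplex ((hπ θ).1 s)]
  norm_num

lemma fisher_eq (M : MDP S A) (π : Param d → S → A → ℝ) (θ : Param d) :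
    M.fisher π θ = ∑ s, ∑ a, (M.stat (π θ) s * π θ s a) •
      vecMulVec (score π θ s a).ofLp (score π θ s a).ofLp := by
  ext i j
  simp [MDP.fisher, Matrix.sum_apply, vecMulVec_apply, mul_sum, mul_assoc]

lemma mul_norm_sq_le_fisher (hF : M.FisherNondegenerate π μ) (θ ω : Param d) :
    μ * ‖ω‖ ^ 2 ≤ ∑ s, ∑ a, M.stat (π θ) s * π θ s a * ⟪score π θ s a, ω⟫ ^ 2 := by
  have h := (hF θ).dotProduct_mulVec_nonneg ω.ofLp
  have hin : ∀ x : Param d, x.ofLp ⬝ᵥ ω.ofLp = ⟪x, ω⟫ := by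
    intro x
    rw [EuclideanSpace.inner_eq_star_dotProduct, star_trivial, dotProduct_comm]
  rw [star_trivial, sub_mulVec, smul_mulVec, one_mulVec, dotProduct_sub, dotProduct_smul, hin,
    real_inner_self_eq_norm_sq, fisher_eq] at h
  simp only [Matrix.sum_mulVec, smul_mulVec, dotProduct_sum, dotProduct_smul, vecMulVec_mulVec,
    smul_eq_mul, sub_nonneg] at h
  refine h.trans (le_of_eq ?_)
  refine sum_congr rfl fun s _ => sum_congr rfl fun a _ => ?_
  simp only [dotProduct_comm ω.ofLp, hin, op_smul_eq_smul, smul_eq_mul]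
  ring

variable [Nonempty S]

/-- The gradient of the average reward at `θ`. -/
noncomputable def polGrad (M : MDP S A) (π : Param d → S → A → ℝ) (θ : Param d) : Param d :=
  ∑ s, ∑ a, (M.stat (π θ) s * π θ s a * M.adv (π θ) s a) • score π θ s a

lemma sum_stat_mul_policy (M : MDP S A) {κ : S → A → ℝ} (hκ : IsPolicy κ) :
    ∑ s, ∑ a, M.stat κ s * κ s a = 1 := by
  simp [← mul_sum, (hκ _).2, (stat_spec M hκ).1.2]

/-- The Fisher form at a unit coordinate vector lies between `μ` and `G ^ 2`; such a vector exists
because `0 < d`. The resulting `1 ≤ G ^ 2 / μ` absorbs lower-order terms later. -/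
lemma mul_le_sq_score_bound [Nonempty A] (hπ : IsPolicyClass π) (hb : ScoreBounds π G B)
    (hF : M.FisherNondegenerate π μ) (hd : 0 < d) : μ ≤ G ^ 2 := by
  have hG := (scoreBounds_nonneg hb).1
  have h := mul_norm_sq_le_fisher hF 0 (EuclideanSpace.single (⟨0, hd⟩ : Fin d) (1 : ℝ))
  rw [PiLp.norm_single, norm_one, one_pow, mul_one] at h
  refine h.trans ?_
  have hs := (stat_spec M (hπ 0).1).1
  calc _ ≤ ∑ s, ∑ a, M.stat (π 0) s * π 0 s a * G ^ 2 := by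
        refine sum_le_sum fun s _ => sum_le_sum fun a _ => ?_
        refine mul_le_mul_of_nonneg_left ?_ (mul_nonneg (hs.1 s) ((hπ 0).2 s a).le)
        refine sq_le_sq' ?_ ?_
        all_goals
          have h1 := abs_real_inner_le_norm (score π 0 s a)
            (EuclideanSpace.single (⟨0, hd⟩ : Fin d) (1 : ℝ))
          rw [PiLp.norm_single, norm_one, mul_one] at h1
          have h2 := abs_le.1 (h1.trans ((hb s a).2.2 0).1)
        exacts [h2.1, h2.2]
    _ = G ^ 2 := by
        simp only [← sum_mul]
        rw [sum_stat_mul_policy M (hπ 0).1, one_mul]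

lemma approxErr_eq (M : MDP S A) (π : Param d → S → A → ℝ) (δ : S → ℝ) (κ : S → A → ℝ)
    (θ ω : Param d) : M.approxErr π δ κ θ ω =
      ∑ s, ∑ a, δ s * κ s a * (⟪score π θ s a, ω⟫ - M.adv (π θ) s a) ^ 2 := by
  simp [MDP.approxErr, mul_sum, mul_assoc]

/-- The natural policy gradient direction exists and is controlled by the gradient. -/
lemma exists_isNPGDirection (hπ : IsPolicyClass π) (hμ : 0 < μ)
    (hF : M.FisherNondegenerate π μ) (θ : Param d) :
    ∃ ω, M.IsNPGDirection π θ ω ∧ μ * ‖ω‖ ≤ ‖polGrad M π θ‖ := by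
  let w : S → A → ℝ := fun s a => M.stat (π θ) s * π θ s a
  have hw : ∀ s a, 0 ≤ w s a := fun s a =>
    mul_nonneg ((stat_spec M (hπ θ).1).1.1 s) ((hπ θ).2 s a).le
  let F : Param d →ₗ[ℝ] Param d :=
    ∑ s, ∑ a, w s a • (innerₛₗ ℝ (score π θ s a)).smulRight (score π θ s a)
  have hFapp : ∀ ω, F ω = ∑ s, ∑ a, (w s a * ⟪score π θ s a, ω⟫) • score π θ s a := by
    intro ω
    simp [F, LinearMap.sum_apply, smul_smul]
  have hFin : ∀ ω ω', ⟪F ω, ω'⟫ =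
      ∑ s, ∑ a, w s a * ⟪score π θ s a, ω⟫ * ⟪score π θ s a, ω'⟫ := by
    intro ω ω'
    simp only [hFapp, sum_inner, real_inner_smul_left]
  have hFpos : ∀ ω, μ * ‖ω‖ ^ 2 ≤ ⟪F ω, ω⟫ := by
    intro ω
    refine (mul_norm_sq_le_fisher hF θ ω).trans (le_of_eq ?_)
    rw [hFin]
    exact sum_congr rfl fun s _ => sum_congr rfl fun a _ => by simp only [w]; ring
  have hinj : Function.Injective F := by
    rw [injective_iff_map_eq_zero]
    intro ω hω
    have := hFpos ω
    rw [hω, inner_zero_left] at this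
    have h2 : ‖ω‖ ^ 2 ≤ 0 := by
      by_contra! hc
      nlinarith
    exact norm_eq_zero.1 (pow_eq_zero_iff two_ne_zero |>.1 (le_antisymm h2 (sq_nonneg _)))
  obtain ⟨ω, hω⟩ := LinearMap.injective_iff_surjective.1 hinj (polGrad M π θ)
  refine ⟨ω, fun ω' => ?_, ?_⟩
  · have hgrad : ∀ u, ⟪polGrad M π θ, u⟫ =
        ∑ s, ∑ a, w s a * M.adv (π θ) s a * ⟪score π θ s a, u⟫ := by
      intro u
      simp only [polGrad, sum_inner, real_inner_smul_left, w]
    -- These are the normal equations: `F ω = polGrad M π θ` says that the residual is orthogonal to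
    -- all linear functions of the score.
    have hzero : ∑ s, ∑ a, w s a * (⟪score π θ s a, ω⟫ - M.adv (π θ) s a) *
        ⟪score π θ s a, ω' - ω⟫ = 0 := by
      have h1 := hFin ω (ω' - ω)
      rw [hω, hgrad] at h1
      simp only [mul_sub, sub_mul, sum_sub_distrib]
      simp only [inner_sub_right, mul_sub, sum_sub_distrib] at h1 ⊢
      linarith
    rw [approxErr_eq, approxErr_eq]
    have hexp : ∑ s, ∑ a, w s a * (⟪score π θ s a, ω'⟫ - M.adv (π θ) s a) ^ 2 =
        ∑ s, ∑ a, w s a * (⟪score π θ s a, ω⟫ - M.adv (π θ) s a) ^ 2 +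
        2 * ∑ s, ∑ a, w s a * (⟪score π θ s a, ω⟫ - M.adv (π θ) s a) *
          ⟪score π θ s a, ω' - ω⟫ +
        ∑ s, ∑ a, w s a * ⟪score π θ s a, ω' - ω⟫ ^ 2 := by
      simp only [mul_sum, ← sum_add_distrib]
      refine sum_congr rfl fun s _ => sum_congr rfl fun a _ => ?_
      rw [inner_sub_right]
      ring
    have hpos : 0 ≤ ∑ s, ∑ a, w s a * ⟪score π θ s a, ω' - ω⟫ ^ 2 :=
      sum_nonneg fun s _ => sum_nonneg fun a _ => mul_nonneg (hw s a) (sq_nonneg _)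
    change ∑ s, ∑ a, w s a * _ ≤ ∑ s, ∑ a, w s a * _
    rw [hexp, hzero]
    linarith
  · have h1 := hFpos ω
    rw [hω] at h1
    have h2 := real_inner_le_norm (polGrad M π θ) ω
    rcases (norm_nonneg ω).eq_or_lt with h0 | h0
    · rw [← h0, mul_zero]
      exact norm_nonneg _
    · refine le_of_mul_le_mul_right ?_ h0
      linarith [sq ‖ω‖, mul_assoc μ ‖ω‖ ‖ω‖]

/-- Gradient domination: the optimality gap is controlled by the gradient. -/
lemma J_sub_le_grad [Nonempty A] (hM : M.Ergodic) (hπ : IsPolicyClass π)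
    (hb : ScoreBounds π G B) {πstar : S → A → ℝ} (hs : IsPolicy πstar) {ε : ℝ}
    (hε : M.TransferErrorLe π πstar ε) (hμ : 0 < μ) (hF : M.FisherNondegenerate π μ)
    (θ : Param d) : M.J πstar - M.J (π θ) ≤ √ε + G / μ * ‖polGrad M π θ‖ := by
  obtain ⟨ω, hω, hωn⟩ := exists_isNPGDirection hπ hμ hF θ
  have hG := (scoreBounds_nonneg hb).1
  have herr := hε θ ω hω
  rw [approxErr_eq] at herr
  set w : S → A → ℝ := fun s a => M.stat πstar s * πstar s a
  have hw : ∀ s a, 0 ≤ w s a := fun s a => mul_nonneg ((stat_spec M hs).1.1 s) ((hs s).1 a)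
  have hw1 : ∑ s, ∑ a, w s a = 1 := sum_stat_mul_policy M hs
  set X : S → A → ℝ := fun s a => ⟪score π θ s a, ω⟫ - M.adv (π θ) s a
  have hJ : M.J πstar - M.J (π θ) =
      ∑ s, ∑ a, w s a * ⟪score π θ s a, ω⟫ - ∑ s, ∑ a, w s a * X s a := by
    rw [J_sub_J hM (hπ θ).1 hs, ← sum_sub_distrib]
    refine sum_congr rfl fun s _ => ?_
    rw [← sum_sub_distrib, mul_sum]
    exact sum_congr rfl fun a _ => by simp only [w, X]; ring
  have h1 : ∑ s, ∑ a, w s a * ⟪score π θ s a, ω⟫ ≤ G * ‖ω‖ := by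
    calc _ ≤ ∑ s, ∑ a, w s a * (G * ‖ω‖) := by
          refine sum_le_sum fun s _ => sum_le_sum fun a _ => mul_le_mul_of_nonneg_left ?_ (hw s a)
          refine (real_inner_le_norm _ _).trans ?_
          have := ((hb s a).2.2 θ).1
          gcongr
      _ = G * ‖ω‖ := by simp only [← sum_mul, hw1, one_mul]
  -- Jensen's inequality, from nonnegativity of the variance of `X` under the weights `w`.
  have h2 : -√ε ≤ ∑ s, ∑ a, w s a * X s a := by
    set m := ∑ s, ∑ a, w s a * X s a with hm
    have hvar : 0 ≤ ∑ s, ∑ a, w s a * (X s a - m) ^ 2 :=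
      sum_nonneg fun s _ => sum_nonneg fun a _ => mul_nonneg (hw s a) (sq_nonneg _)
    have hexp : ∑ s, ∑ a, w s a * (X s a - m) ^ 2 =
        ∑ s, ∑ a, w s a * X s a ^ 2 - 2 * m * (∑ s, ∑ a, w s a * X s a) +
          m ^ 2 * ∑ s, ∑ a, w s a := by
      simp only [mul_sum, ← sum_add_distrib, ← sum_sub_distrib]
      exact sum_congr rfl fun s _ => sum_congr rfl fun a _ => by ring
    rw [hw1, ← hm] at hexp
    have hle : m ^ 2 ≤ ε := by
      refine le_trans ?_ herr
      nlinarith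
    exact (abs_le.1 (Real.abs_le_sqrt hle)).1
  have h3 : G * ‖ω‖ ≤ G / μ * ‖polGrad M π θ‖ := by
    rw [div_mul_eq_mul_div, le_div_iff₀ hμ]
    nlinarith
  linarith

lemma continuous_stat (hM : M.Ergodic) (hπ : IsPolicyClass π) (hb : ScoreBounds π G B) (s : S) :
    Continuous fun θ => M.stat (π θ) s := by
  have hmix := (tmix_spec hM fun θ => (hπ θ).1).2
  refine (LipschitzWith.of_dist_le' (K := 4 / 3 * M.tmix π * G) fun θ θ' => ?_).continuous
  have h := l1_stat_sub_stat_le (hπ θ').1 (hπ θ).1 (hmix θ')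
    fun s => l1_policy_sub_le hπ hb θ' θ s
  rw [Real.dist_eq, dist_eq_norm, mul_assoc]
  exact (single_le_sum (f := fun s => |(M.stat (π θ) - M.stat (π θ')) s|)
    (fun _ _ => abs_nonneg _) (mem_univ s)).trans h

lemma continuous_J (hM : M.Ergodic) (hπ : IsPolicyClass π) (hb : ScoreBounds π G B) :
    Continuous fun θ => M.J (π θ) := by
  have h : (fun θ => M.J (π θ)) = fun θ => ∑ s, M.stat (π θ) s * ∑ a, M.r s a * π θ s a :=
    funext fun θ => J_eq hM (hπ θ).1
  rw [h]
  have h1 := continuous_stat hM hπ hb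
  have h2 := continuous_policy hπ hb
  fun_prop

/-- Where `g` vanishes the product rule needs only continuity of `f`. This spares differentiating
the stationary distribution in the policy gradient theorem. -/
lemma hasDerivAt_mul_of_eq_zero {f g : ℝ → ℝ} {x g' : ℝ} (hf : ContinuousAt f x)
    (hg : HasDerivAt g g' x) (hx : g x = 0) :
    HasDerivAt (fun y => f y * g y) (f x * g') x := by
  rw [hasDerivAt_iff_tendsto_slope] at hg ⊢
  refine ((hf.tendsto.mono_left nhdsWithin_le_nhds).mul hg).congr fun y => ?_
  simp only [slope_def_field, hx]
  ring

/-- The policy gradient theorem, along a line. -/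
lemma hasDerivAt_J (hM : M.Ergodic) (hπ : IsPolicyClass π) (hb : ScoreBounds π G B)
    (θ u : Param d) :
    HasDerivAt (fun h : ℝ => M.J (π (θ + h • u))) ⟪polGrad M π θ, u⟫ 0 := by
  let φ : S → ℝ → ℝ := fun s h => ∑ a, π (θ + h • u) s a * M.adv (π θ) s a
  -- By the performance difference lemma the increment of `J` is a sum of products whose second
  -- factor `φ s` vanishes at `0`, because advantages average to zero under their own policy.
  have hJ : (fun h : ℝ => M.J (π (θ + h • u))) =
      fun h => M.J (π θ) + ∑ s, M.stat (π (θ + h • u)) s * φ s h := by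
    funext h
    rw [← J_sub_J hM (hπ θ).1 (hπ (θ + h • u)).1]
    ring
  have hline : HasDerivAt (fun h : ℝ => θ + h • u) u 0 := by
    simpa using ((hasDerivAt_id (0 : ℝ)).smul_const u).const_add θ
  have hφ : ∀ s, HasDerivAt (φ s) (∑ a, π θ s a * ⟪score π θ s a, u⟫ * M.adv (π θ) s a) 0 := by
    intro s
    refine HasDerivAt.fun_sum fun a _ => HasDerivAt.mul_const ?_ _
    have h0 : θ + (0 : ℝ) • u = θ := by simp
    have h1 := hasFDerivAt_policy hπ hb θ s a
    rw [← h0] at h1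
    have := h1.comp_hasDerivAt (0 : ℝ) hline
    rw [h0] at this
    exact this.congr_deriv (by simp)
  have hφ0 : ∀ s, φ s 0 = 0 := by
    intro s
    simpa [φ] using sum_policy_mul_adv hM (hπ θ).1 s
  have hstat : ∀ s, ContinuousAt (fun h : ℝ => M.stat (π (θ + h • u)) s) 0 := fun s =>
    ((continuous_stat hM hπ hb s).comp (by fun_prop : Continuous fun h : ℝ => θ + h • u)).continuousAt
  have hsum := (HasDerivAt.fun_sum fun s (_ : s ∈ univ) =>
    hasDerivAt_mul_of_eq_zero (hstat s) (hφ s) (hφ0 s)).const_add (M.J (π θ))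
  rw [hJ]
  refine hsum.congr_deriv ?_
  simp only [polGrad, sum_inner, real_inner_smul_left, mul_sum, zero_smul, add_zero]
  exact sum_congr rfl fun s _ => sum_congr rfl fun a _ => by ring

/-- Below every parameter there are almost critical points of the average reward. -/
lemma exists_small_grad (hM : M.Ergodic) (hπ : IsPolicyClass π) (hb : ScoreBounds π G B)
    (θ₁ : Param d) {δ : ℝ} (hδ : 0 < δ) :
    ∃ θ, M.J (π θ) ≤ M.J (π θ₁) ∧ ‖polGrad M π θ‖ ≤ δ := by
  -- At a minimizer `θ` of `f`, `‖∇J‖ ≤ 2 c ‖θ - θ₁‖`, while `0 ≤ J ≤ 1` forces `c ‖θ - θ₁‖² ≤ 1`.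
  -- Together `‖∇J‖² ≤ 4 c = δ ^ 2`.
  set c : ℝ := δ ^ 2 / 4 with hc
  have hc0 : 0 < c := by positivity
  have hJ := fun θ => J_mem hM (hπ θ).1
  let f : Param d → ℝ := fun θ => M.J (π θ) + c * ‖θ - θ₁‖ ^ 2
  have hf : Continuous f := (continuous_J hM hπ hb).add (by fun_prop)
  -- At distance `1 + 1 / c` from `θ₁` the penalty alone is at least `1`, hence at least `J (θ₁)`,
  -- so a minimizer exists.
  have hcoer : ∀ᶠ θ in cocompact (Param d), f θ₁ ≤ f θ := by
    have h := tendsto_norm_cocompact_atTop (E := Param d) |>.eventually_ge_atTop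
      (‖θ₁‖ + (1 + 1 / c))
    filter_upwards [h] with θ hθ
    have h1 : 1 + 1 / c ≤ ‖θ - θ₁‖ := by
      have := norm_sub_norm_le θ θ₁
      linarith
    have h2 : 0 < 1 / c := by positivity
    have h3 : 1 ≤ c * ‖θ - θ₁‖ ^ 2 := by
      have h4 : 1 / c ≤ ‖θ - θ₁‖ ^ 2 := by nlinarith
      calc 1 = c * (1 / c) := by field_simp
        _ ≤ _ := by gcongr
    simp only [f, sub_self, norm_zero]
    have := (hJ θ₁).2
    have := (hJ θ).1
    norm_num
    linarith
  obtain ⟨θ, hθ⟩ := hf.exists_forall_le' θ₁ hcoer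
  have hmin : M.J (π θ) + c * ‖θ - θ₁‖ ^ 2 ≤ M.J (π θ₁) := by
    simpa [f] using hθ θ₁
  refine ⟨θ, by nlinarith [sq_nonneg ‖θ - θ₁‖], ?_⟩
  set b := polGrad M π θ with hbdef
  have hder : HasDerivAt (fun h : ℝ => f (θ + h • b))
      (⟪b, b⟫ + c * (2 * ⟪θ - θ₁, b⟫)) 0 := by
    refine (hasDerivAt_J hM hπ hb θ b).add ?_
    have hline : HasDerivAt (fun h : ℝ => θ + h • b - θ₁) b 0 := by
      simpa using (((hasDerivAt_id (0 : ℝ)).smul_const b).const_add θ).sub_const θ₁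
    simpa using hline.norm_sq.const_mul c
  have hloc : IsLocalMin (fun h : ℝ => f (θ + h • b)) 0 :=
    Eventually.of_forall fun h => by simpa using hθ (θ + h • b)
  have hz := hloc.hasDerivAt_eq_zero hder
  rw [real_inner_self_eq_norm_sq] at hz
  have hcs := abs_le.1 (abs_real_inner_le_norm (θ - θ₁) b)
  have hb1 : ‖b‖ ≤ 2 * c * ‖θ - θ₁‖ := by
    rcases (norm_nonneg b).eq_or_lt with h0 | h0
    · rw [← h0]; positivity
    · refine le_of_mul_le_mul_right ?_ h0
      nlinarith
  have hsq : ‖b‖ ^ 2 ≤ δ ^ 2 := by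
    have h1 : c * ‖θ - θ₁‖ ^ 2 ≤ 1 := by linarith [(hJ θ₁).2, (hJ θ).1]
    calc ‖b‖ ^ 2 ≤ (2 * c * ‖θ - θ₁‖) ^ 2 := by gcongr
      _ = 4 * c * (c * ‖θ - θ₁‖ ^ 2) := by ring
      _ ≤ 4 * c * 1 := by gcongr
      _ = δ ^ 2 := by rw [hc]; ring
  exact (sq_le_sq₀ (norm_nonneg _) hδ.le).1 hsq

/-- Since the Fisher matrix is nondegenerate on all of the parameter space, every policy of the
class is optimal up to the transferred approximation error. -/
lemma J_sub_le_sqrt [Nonempty A] (hM : M.Ergodic) (hπ : IsPolicyClass π)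
    (hb : ScoreBounds π G B) {πstar : S → A → ℝ} (hs : IsPolicy πstar) {ε : ℝ}
    (hε : M.TransferErrorLe π πstar ε) (hμ : 0 < μ) (hF : M.FisherNondegenerate π μ)
    (θ : Param d) : M.J πstar - M.J (π θ) ≤ √ε := by
  have hG := (scoreBounds_nonneg hb).1
  refine le_of_forall_pos_le_add fun η hη => ?_
  -- The `+ 1` keeps the denominator positive even when `G / μ` is zero.
  obtain ⟨θ', h1, h2⟩ := exists_small_grad hM hπ hb θ (δ := η / (G / μ + 1)) (by positivity)
  have h3 := J_sub_le_grad hM hπ hb hs hε hμ hF θ'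
  have h4 : G / μ * ‖polGrad M π θ'‖ ≤ η := by
    calc G / μ * ‖polGrad M π θ'‖ ≤ (G / μ + 1) * (η / (G / μ + 1)) := by
          gcongr
          linarith
      _ = η := by field_simp
  linarith

end PolicyClass

/-! ### Causality: the executed parameters depend only on the past -/

section Locality

variable {S A : Type*} [Fintype S] [DecidableEq S] [Fintype A] [DecidableEq A] {d : ℕ}

/-- The scan reads only times up to `len - 1`. With `len = 0`, truncated subtraction would still
allow a reading at time `0`, hence `0 < len`. -/
lemma visitsFrom_congr {τ τ' : Traj S A} {len : ℕ} (hlen : 0 < len)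
    (h : ∀ i < len, τ i = τ' i) (N : ℕ) (s : S) (fuel ξ : ℕ) :
    visitsFrom τ len N s fuel ξ = visitsFrom τ' len N s fuel ξ := by
  induction fuel generalizing ξ with
  | zero => rfl
  | succ fuel ih =>
    simp only [visitsFrom]
    split_ifs with h1 h2 h3 h3
    · rw [ih]
    · exact absurd (h ξ (by lia) ▸ h2) h3
    · exact absurd (h ξ (by lia) ▸ h3) h2
    · rw [ih]
    · rfl

lemma add_le_of_mem_visitsFrom {τ : Traj S A} {len N : ℕ} {s : S} {fuel ξ ξ' : ℕ}
    (h : ξ' ∈ visitsFrom τ len N s fuel ξ) : ξ' + N ≤ len - 1 := by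
  induction fuel generalizing ξ with
  | zero => simp [visitsFrom] at h
  | succ fuel ih =>
    simp only [visitsFrom] at h
    split_ifs at h with h1 h2
    · rcases List.mem_cons.1 h with rfl | h
      · exact h1
      · exact ih h
    · exact ih h
    · simp at h

lemma subReward_congr (M : MDP S A) {τ τ' : Traj S A} {len : ℕ} (hlen : 0 < len)
    (h : ∀ i < len, τ i = τ' i) {N ξ : ℕ} (hξ : ξ + N ≤ len - 1) :
    M.subReward τ N ξ = M.subReward τ' N ξ :=
  sum_congr rfl fun t ht => by
    rw [h (ξ + t) (by have := mem_range.1 ht; lia)]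

lemma Vhat_congr (M : MDP S A) {τ τ' : Traj S A} {len : ℕ} (hlen : 0 < len)
    (h : ∀ i < len, τ i = τ' i) (N : ℕ) (s : S) :
    M.Vhat τ len N s = M.Vhat τ' len N s := by
  have hv : visits τ len N s = visits τ' len N s := visitsFrom_congr hlen h N s _ _
  simp only [MDP.Vhat, hv]
  congr 2
  exact List.map_congr_left fun ξ hξ =>
    subReward_congr M hlen h (add_le_of_mem_visitsFrom hξ)

lemma QhatNum_congr (M : MDP S A) {τ τ' : Traj S A} {len : ℕ} (hlen : 0 < len)
    (h : ∀ i < len, τ i = τ' i) (N : ℕ) (s : S) (a : A) :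
    M.QhatNum τ len N s a = M.QhatNum τ' len N s a := by
  have hv : visits τ len N s = visits τ' len N s := visitsFrom_congr hlen h N s _ _
  simp only [MDP.QhatNum, hv]
  congr 2
  refine List.map_congr_left fun ξ hξ => ?_
  have hle := add_le_of_mem_visitsFrom hξ
  rw [subReward_congr M hlen h hle, h ξ (by lia)]

lemma gradEst_congr (M : MDP S A) (π : Param d → S → A → ℝ) {τ τ' : Traj S A} {len : ℕ}
    (hlen : 0 < len) (h : ∀ i < len, τ i = τ' i) (N : ℕ) (θ : Param d) :
    M.gradEst π len N θ τ = M.gradEst π len N θ τ' := by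
  simp only [MDP.gradEst, MDP.Ahat, MDP.Qhat, Vhat_congr M hlen h, QhatNum_congr M hlen h]
  congr 1
  exact sum_congr rfl fun t ht => by rw [h t (mem_Ico.1 ht).2]

lemma Phi_congr (M : MDP S A) (π : Param d → S → A → ℝ) {τ τ' : Traj S A} {len : ℕ}
    (hlen : 0 < len) (h : ∀ i < len, τ i = τ' i) (N : ℕ) :
    M.Phi π len N τ = M.Phi π len N τ' := by
  funext θ
  simp only [MDP.Phi, Vhat_congr M hlen h, QhatNum_congr M hlen h]
  congr 1
  exact sum_congr rfl fun t ht => by rw [h t (mem_Ico.1 ht).2]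

lemma hessEst_congr (M : MDP S A) (π : Param d → S → A → ℝ) {τ τ' : Traj S A} {len : ℕ}
    (hlen : 0 < len) (h : ∀ i < len, τ i = τ' i) (N : ℕ) (θ u : Param d) :
    M.hessEst π len N θ τ u = M.hessEst π len N θ τ' u := by
  have hg : gradLogProb π len θ τ = gradLogProb π len θ τ' :=
    sum_congr rfl fun t ht => by rw [h t (mem_range.1 ht)]
  simp only [MDP.hessEst, Phi_congr M π hlen h, hg]

/-- The memory at the start of an epoch depends only on the past. -/
lemma memory_congr (M : MDP S A) (π : Param d → S → A → ℝ) {I : Input d} (hI : 0 < I.half)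
    (q : ℕ → unitInterval) {x y : Traj S A} {k : ℕ} (h : ∀ t < k * (2 * I.half), x t = y t) :
    M.memory π I q x k = M.memory π I q y k := by
  induction k with
  | zero => rfl
  | succ k ih =>
    have hk : (k + 1) * (2 * I.half) = k * (2 * I.half) + 2 * I.half := by ring
    have hm := ih fun t ht => h t (by lia)
    simp only [MDP.memory, MDP.direction, hm]
    rw [gradEst_congr M π hI fun i hi => h (k * (2 * I.half) + i) (by lia),
      hessEst_congr M π hI fun i hi => h (k * (2 * I.half) + I.half + i) (by lia)]

/-- Only completed epochs enter the memory. This is what makes the factors of `runProb` conditional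
probabilities given the past. -/
lemma paramAt_congr (M : MDP S A) (π : Param d → S → A → ℝ) {I : Input d} (hI : 0 < I.half)
    (q : ℕ → unitInterval) {x y : Traj S A} {t : ℕ} (h : ∀ i < t, x i = y i) :
    M.paramAt π I q x t = M.paramAt π I q y t := by
  simp only [MDP.paramAt]
  rw [memory_congr M π hI q fun i hi => h i (hi.trans_le (Nat.div_mul_le_self _ _))]

end Locality

/-! ### Expectations along the run and the telescoping Poisson argument -/

section Run

variable {S A : Type*} [Fintype S] [DecidableEq S] [Nonempty S] [Fintype A] [DecidableEq A]
  [Nonempty A] {M : MDP S A} {d : ℕ} {π : Param d → S → A → ℝ} {I : Input d}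

/-- The conditional law of the state at time `n` given the past. -/
noncomputable def nextLaw (M : MDP S A) (n : ℕ) (x : Traj S A) (s : S) : ℝ :=
  if n = 0 then M.ρ s else M.P (x (n - 1)).1 (x (n - 1)).2 s

lemma nextLaw_mem (M : MDP S A) (n : ℕ) (x : Traj S A) : nextLaw M n x ∈ stdSimplex ℝ S := by
  have : nextLaw M n x = if n = 0 then M.ρ else M.P (x (n - 1)).1 (x (n - 1)).2 := by
    funext s
    simp only [nextLaw]
    split_ifs <;> rfl
  rw [this]
  split_ifs
  exacts [M.ρ_mem, M.P_mem _ _]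

/-- The expectation of a function of the first `n` state-action pairs of the run, given the
uniform random numbers `q`. -/
noncomputable def runExp (M : MDP S A) (π : Param d → S → A → ℝ) (I : Input d)
    (q : ℕ → unitInterval) (n : ℕ) (f : Traj S A → ℝ) : ℝ :=
  ∑ x : Fin n → S × A, M.runProb π I n q (extend x) * f (extend x)

lemma extend_snoc {n : ℕ} (x : Fin n → S × A) (y : S × A) :
    extend (Fin.snoc (α := fun _ => S × A) x y) = Function.update (extend x) n y := by
  funext t
  rcases lt_trichotomy t n with h | rfl | h
  · rw [Function.update_of_ne h.ne]
    simp only [extend, h, h.trans (Nat.lt_succ_self n), dite_true]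
    exact Fin.snoc_castSucc (α := fun _ => S × A) y x ⟨t, h⟩
  · rw [Function.update_self]
    simp only [extend, Nat.lt_succ_self, dite_true]
    exact Fin.snoc_last (α := fun _ => S × A) y x
  · rw [Function.update_of_ne h.ne']
    simp [extend, h.not_gt, (Nat.succ_le_of_lt h).not_gt]

lemma runProb_succ (M : MDP S A) (π : Param d → S → A → ℝ) (I : Input d)
    (q : ℕ → unitInterval) (n : ℕ) (x : Traj S A) :
    M.runProb π I (n + 1) q x = M.runProb π I n q x *
      (nextLaw M n x (x n).1 * π (M.paramAt π I q x n) (x n).1 (x n).2) := by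
  simp only [MDP.runProb, prod_range_succ, nextLaw]
  rcases n.eq_zero_or_pos with rfl | h
  · simp
  · simp [h.ne']

lemma runProb_congr (hI : 0 < I.half) (q : ℕ → unitInterval) {n : ℕ} {x y : Traj S A}
    (h : ∀ t < n, x t = y t) : M.runProb π I n q x = M.runProb π I n q y := by
  refine prod_congr rfl fun t ht => ?_
  have ht' := mem_range.1 ht
  rw [paramAt_congr M π hI q fun i hi => h i (hi.trans ht'), h t ht', h (t - 1) (by lia),
    h 0 (by lia)]

lemma nextLaw_congr {n : ℕ} {x y : Traj S A} (h : ∀ t < n, x t = y t) :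
    nextLaw M n x = nextLaw M n y := by
  funext s
  simp only [nextLaw]
  split_ifs with hn
  · rfl
  · rw [h (n - 1) (by lia)]

/-- The tower property: by causality, appending the pair at time `n` leaves the probability of the
earlier pairs and the parameter at time `n` unchanged. -/
lemma runExp_succ (hI : 0 < I.half) (q : ℕ → unitInterval) (n : ℕ) (f : Traj S A → ℝ) :
    runExp M π I q (n + 1) f = runExp M π I q n fun x =>
      ∑ s, nextLaw M n x s * ∑ a, π (M.paramAt π I q x n) s a *
        f (Function.update x n (s, a)) := by
  have hup : ∀ (x : Traj S A) (y : S × A), ∀ t < n, Function.update x n y t = x t :=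
    fun x y t ht => Function.update_of_ne ht.ne _ _
  unfold runExp
  rw [← (Fin.snocEquiv fun _ : Fin (n + 1) => S × A).sum_comp, Fintype.sum_prod_type, sum_comm]
  refine sum_congr rfl fun x _ => ?_
  rw [Fintype.sum_prod_type, mul_sum]
  refine sum_congr rfl fun s _ => ?_
  rw [mul_sum, mul_sum]
  refine sum_congr rfl fun a _ => ?_
  change M.runProb π I (n + 1) q (extend (Fin.snoc (α := fun _ => S × A) x (s, a))) *
    f (extend (Fin.snoc (α := fun _ => S × A) x (s, a))) = _
  rw [extend_snoc, runProb_succ, runProb_congr hI q (hup _ _), nextLaw_congr (hup _ _),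
    paramAt_congr M π hI q (hup _ _), Function.update_self]
  ring

lemma runProb_nonneg (hπ : IsPolicyClass π) (q : ℕ → unitInterval) (n : ℕ) (x : Traj S A) :
    0 ≤ M.runProb π I n q x := by
  induction n with
  | zero => simp [MDP.runProb]
  | succ n ih =>
    rw [runProb_succ]
    exact mul_nonneg ih (mul_nonneg ((nextLaw_mem M n x).1 _) ((hπ _).2 _ _).le)

lemma runProb_le_one (hπ : IsPolicyClass π) (q : ℕ → unitInterval) (n : ℕ) (x : Traj S A) :
    M.runProb π I n q x ≤ 1 := by
  induction n with
  | zero => simp [MDP.runProb]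
  | succ n ih =>
    rw [runProb_succ]
    have h1 := nextLaw_mem M n x
    have h2 := (hπ (M.paramAt π I q x n)).1 (x n).1
    have h3 : (nextLaw M n x) (x n).1 ≤ 1 := by
      rw [← h1.2]
      exact single_le_sum (fun i _ => h1.1 i) (mem_univ _)
    have h4 : π (M.paramAt π I q x n) (x n).1 (x n).2 ≤ 1 := by
      rw [← h2.2]
      exact single_le_sum (fun i _ => h2.1 i) (mem_univ _)
    exact mul_le_one₀ ih (mul_nonneg (h1.1 _) (h2.1 _)) (mul_le_one₀ h3 (h2.1 _) h4)

lemma runExp_add (q : ℕ → unitInterval) (n : ℕ) (f g : Traj S A → ℝ) :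
    runExp M π I q n (fun x => f x + g x) = runExp M π I q n f + runExp M π I q n g := by
  simp [runExp, mul_add, sum_add_distrib]

lemma runExp_mono (hπ : IsPolicyClass π) (q : ℕ → unitInterval) (n : ℕ) {f g : Traj S A → ℝ}
    (h : ∀ x, f x ≤ g x) : runExp M π I q n f ≤ runExp M π I q n g :=
  sum_le_sum fun _ _ => mul_le_mul_of_nonneg_left (h _) (runProb_nonneg hπ q n _)

lemma runExp_const (hI : 0 < I.half) (hπ : IsPolicyClass π) (q : ℕ → unitInterval) (n : ℕ)
    (c : ℝ) : runExp M π I q n (fun _ => c) = c := by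
  induction n with
  | zero => simp [runExp, MDP.runProb]
  | succ n ih =>
    rw [runExp_succ hI]
    simpa only [← sum_mul, ((hπ _).1 _).2, one_mul, (nextLaw_mem M n _).2] using ih

/-- The relative cost function: minus the value function, normalized at a reference state. -/
noncomputable def relCost (M : MDP S A) (π : Param d → S → A → ℝ) (θ : Param d) (s : S) : ℝ :=
  M.V (π θ) (Classical.arbitrary S) - M.V (π θ) s

/-- The Poisson equation for the cost `J - r`; adding a constant to the value function does not
affect it. -/
lemma relCost_eq (hM : M.Ergodic) (hπ : IsPolicyClass π) (θ : Param d) (s : S) :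
    ∑ a, π θ s a * (M.J (π θ) - M.r s a + ∑ s', M.P s a s' * relCost M π θ s') =
      relCost M π θ s := by
  have h1 : ∀ a, ∑ s', M.P s a s' * relCost M π θ s' =
      M.V (π θ) (Classical.arbitrary S) - ∑ s', M.P s a s' * M.V (π θ) s' := by
    intro a
    simp [relCost, mul_sub, sum_sub_distrib, ← sum_mul, (M.P_mem s a).2]
  have h2 := V_eq hM (hπ θ).1 s
  simp only [h1, mul_add, mul_sub, sum_add_distrib, sum_sub_distrib, ← sum_mul, ((hπ θ).1 s).2,
    one_mul, sum_policy_mul_next]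
  simp only [MDP.rew, mul_comm (M.r s _)] at h2
  rw [relCost]
  linarith

/-- The loss with respect to the average rewards of the executed policies is controlled by the
changes of the relative cost function along the run. -/
lemma runExp_sum_J_sub_r_le (hM : M.Ergodic) (hπ : IsPolicyClass π) (hI : 0 < I.half)
    (q : ℕ → unitInterval) {u : ℝ} (hu : ∀ θ s, |relCost M π θ s| ≤ u) {b : ℕ → ℝ}
    (hb : ∀ n x s, relCost M π (M.paramAt π I q x (n + 1)) s -
      relCost M π (M.paramAt π I q x n) s ≤ b n) (T : ℕ) :
    runExp M π I q T (fun x => ∑ t ∈ range T,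
      (M.J (π (M.paramAt π I q x t)) - M.r (x t).1 (x t).2)) ≤ 2 * u + ∑ n ∈ range T, b n := by
  let f : ℕ → Traj S A → ℝ := fun n x => ∑ t ∈ range n,
    (M.J (π (M.paramAt π I q x t)) - M.r (x t).1 (x t).2)
  let g : ℕ → Param d → Traj S A → ℝ := fun n θ x => ∑ s, nextLaw M n x s * relCost M π θ s
  have hg : ∀ n θ x, |g n θ x| ≤ u := by
    intro n θ x
    have := abs_dotProduct_le (v := nextLaw M n x) (hu θ)
    rwa [l1_of_mem_stdSimplex (nextLaw_mem M n x), one_mul] at this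
  -- Accumulated loss plus expected relative cost of the next state is preserved in expectation, as
  -- long as the relative cost is still that of the policy used at time `n`. Passing to the policy
  -- of time `n + 1` then costs at most `b n`.
  have hstep : ∀ n, runExp M π I q (n + 1)
      (fun x => f (n + 1) x + g (n + 1) (M.paramAt π I q x n) x) =
      runExp M π I q n (fun x => f n x + g n (M.paramAt π I q x n) x) := by
    intro n
    rw [runExp_succ hI]
    congr 1
    funext x
    have hup : ∀ y : S × A, ∀ t < n, Function.update x n y t = x t :=
      fun y t ht => Function.update_of_ne ht.ne _ _
    have hf : ∀ y : S × A, f (n + 1) (Function.update x n y) =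
        f n x + (M.J (π (M.paramAt π I q x n)) - M.r y.1 y.2) := by
      intro y
      simp only [f, sum_range_succ, Function.update_self]
      rw [paramAt_congr M π hI q (hup y)]
      congr 1
      refine sum_congr rfl fun t ht => ?_
      have ht' := mem_range.1 ht
      rw [paramAt_congr M π hI q fun i hi => hup y i (hi.trans ht'), hup y t ht']
    have hg' : ∀ y : S × A, g (n + 1) (M.paramAt π I q (Function.update x n y) n)
        (Function.update x n y) =
        ∑ s', M.P y.1 y.2 s' * relCost M π (M.paramAt π I q x n) s' := by
      intro y
      simp only [g, nextLaw, Nat.succ_ne_zero, if_false, Nat.add_sub_cancel, Function.update_self]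
      rw [paramAt_congr M π hI q (hup y)]
    simp only [hf, hg', add_assoc]
    set θ := M.paramAt π I q x n
    have h1 : ∀ s, ∑ a, π θ s a * (f n x + (M.J (π θ) - M.r s a +
        ∑ s', M.P s a s' * relCost M π θ s')) = f n x + relCost M π θ s := by
      intro s
      simp only [mul_add (π θ s _) (f n x), sum_add_distrib, ← sum_mul, ((hπ θ).1 s).2, one_mul]
      rw [relCost_eq hM hπ θ s]
    simp only [h1]
    simp only [mul_add, sum_add_distrib, ← sum_mul, (nextLaw_mem M n x).2, one_mul, g]
  have hΨ : ∀ n, runExp M π I q n (fun x => f n x + g n (M.paramAt π I q x n) x) ≤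
      u + ∑ m ∈ range n, b m := by
    intro n
    induction n with
    | zero =>
      refine (runExp_mono hπ q 0 fun x => ?_).trans (le_of_eq (runExp_const hI hπ q 0 _))
      simpa [f] using (le_abs_self _).trans (hg 0 _ x)
    | succ n ih =>
      rw [sum_range_succ, ← add_assoc, ← runExp_const (M := M) hI hπ q (n + 1) (b n)]
      refine le_trans ?_ (add_le_add_left ((hstep n).le.trans ih) _)
      rw [← runExp_add]
      refine runExp_mono hπ q _ fun x => ?_
      have : g (n + 1) (M.paramAt π I q x (n + 1)) x - g (n + 1) (M.paramAt π I q x n) x ≤ b n := by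
        have hw := nextLaw_mem M (n + 1) x
        calc _ = ∑ s, nextLaw M (n + 1) x s * (relCost M π (M.paramAt π I q x (n + 1)) s -
              relCost M π (M.paramAt π I q x n) s) := by
              simp only [g, mul_sub, sum_sub_distrib]
          _ ≤ ∑ s, nextLaw M (n + 1) x s * b n :=
              sum_le_sum fun s _ => mul_le_mul_of_nonneg_left (hb n x s) (hw.1 s)
          _ = b n := by rw [← sum_mul, hw.2, one_mul]
      linarith
  have hfin := hΨ T
  have hlow : runExp M π I q T (f T) ≤
      runExp M π I q T (fun x => f T x + g T (M.paramAt π I q x T) x) + u := by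
    have hc := runExp_const (M := M) hI hπ q T u
    refine le_trans ?_ (add_le_add_right hc.le _)
    rw [← runExp_add]
    refine runExp_mono hπ q _ fun x => ?_
    have := (abs_le.1 (hg T (M.paramAt π I q x T) x)).1
    linarith
  change runExp M π I q T (f T) ≤ _
  linarith

end Run

/-! ### Length of the path of executed policies -/

section PathLength

variable {S A : Type*} [Fintype S] [DecidableEq S] [Nonempty S] [Fintype A] [DecidableEq A]
  [Nonempty A] {M : MDP S A} {d : ℕ} {π : Param d → S → A → ℝ} {I : Input d} {G B μ : ℝ}

/-- Normalization caps the step at `γ`, whatever the estimates are; if `d_k = 0` the step is zero.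
-/
lemma norm_cur_sub_cur_le (M : MDP S A) (π : Param d → S → A → ℝ) (q : ℕ → unitInterval)
    (x : Traj S A) (k : ℕ) (hγ : 0 ≤ I.γ (k + 1)) :
    ‖(M.memory π I q x (k + 1)).cur - (M.memory π I q x k).cur‖ ≤ I.γ (k + 1) := by
  simp only [MDP.memory, add_sub_cancel_left, norm_smul, norm_div, norm_norm,
    Real.norm_of_nonneg hγ]
  rcases eq_or_ne ‖MDP.direction M π I (k + 1) (q (k + 1))
    (fun i => x (k * (2 * I.half) + i)) (fun i => x (k * (2 * I.half) + I.half + i))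
    (M.memory π I q x k)‖ 0 with h | h
  · rw [h, mul_zero]
    exact hγ
  · rw [div_mul_cancel₀ _ h]

lemma norm_mid_sub_cur_le (m : Memory d) (q : unitInterval) :
    ‖m.mid q - m.cur‖ ≤ ‖m.cur - m.prev‖ := by
  have h : m.mid q - m.cur = (1 - (q : ℝ)) • (m.prev - m.cur) := by
    simp only [Memory.mid]
    module
  rw [h, norm_smul, norm_sub_rev m.cur, Real.norm_of_nonneg (by linarith [q.2.2])]
  exact mul_le_of_le_one_left (norm_nonneg _) (by linarith [q.2.1])

/-- A bound on the `ℓ¹` distance of consecutive policies, by the number of the epoch. -/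
noncomputable def stepBound (G μ : ℝ) (k : ℕ) : ℝ := 6 * (G ^ 2 / μ) / ((k : ℝ) + 2)

lemma stepBound_nonneg (hμ : 0 < μ) (k : ℕ) : 0 ≤ stepBound G μ k := by
  unfold stepBound
  positivity

lemma l1_cur_succ_le (hπ : IsPolicyClass π) (hb : ScoreBounds π G B) (hμ : 0 < μ)
    (hγ : ∀ k, I.γ k = 6 * G / (μ * ((k : ℝ) + 2)))
    (q : ℕ → unitInterval) (x : Traj S A) (k : ℕ) (s : S) :
    l1 (π (M.memory π I q x (k + 1)).cur s - π (M.memory π I q x k).cur s) ≤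
      stepBound G μ (k + 1) := by
  have hG := (scoreBounds_nonneg hb).1
  have hγ0 : 0 ≤ I.γ (k + 1) := by rw [hγ]; positivity
  refine (l1_policy_sub_le hπ hb _ _ s).trans ?_
  refine (mul_le_mul_of_nonneg_left (norm_cur_sub_cur_le M π q x k hγ0) hG).trans (le_of_eq ?_)
  rw [hγ, stepBound]
  field_simp

lemma l1_mid_le (hπ : IsPolicyClass π) (hb : ScoreBounds π G B) (hμ : 0 < μ) (hμG : μ ≤ G ^ 2)
    (hγ : ∀ k, I.γ k = 6 * G / (μ * ((k : ℝ) + 2)))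
    (q : ℕ → unitInterval) (x : Traj S A) (k : ℕ) (p : unitInterval) (s : S) :
    l1 (π ((M.memory π I q x k).mid p) s - π (M.memory π I q x k).cur s) ≤ stepBound G μ k := by
  have hG := (scoreBounds_nonneg hb).1
  cases k with
  | zero =>
    -- In the first epoch `θ₀` and `θ₁` are arbitrary, so only the trivial bound `2` is available;
    -- it is below `stepBound G μ 0 = 3 G² / μ` because `μ ≤ G²`.
    refine (l1_policy_sub_le_two hπ _ _ s).trans ?_
    have : 1 ≤ G ^ 2 / μ := (one_le_div hμ).2 hμG
    simp only [stepBound, Nat.cast_zero, zero_add]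
    linarith
  | succ k =>
    have hγ0 : 0 ≤ I.γ (k + 1) := by rw [hγ]; positivity
    refine (l1_policy_sub_le hπ hb _ _ s).trans ?_
    have h := (norm_mid_sub_cur_le (M.memory π I q x (k + 1)) p).trans
      (norm_cur_sub_cur_le M π q x k hγ0)
    refine (mul_le_mul_of_nonneg_left h hG).trans (le_of_eq ?_)
    rw [hγ, stepBound]
    field_simp

/-- A bound on the length of the path of executed policies up to time `n`. -/
noncomputable def pathBound (G μ : ℝ) (half n : ℕ) : ℝ :=
  -- Entering the second half of epoch index `k` costs `stepBound k`; going on to the next epoch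
  -- costs `stepBound k + stepBound (k + 1)`. The formula accumulates these costs, with an offset
  -- `stepBound 0` when `n = 0` and `half` is positive.
  let k := n / (2 * half)
  if n % (2 * half) < half then
    2 * ∑ i ∈ range k, stepBound G μ i + ∑ i ∈ range (k + 1), stepBound G μ i
  else ∑ i ∈ range k, stepBound G μ i + 2 * ∑ i ∈ range (k + 1), stepBound G μ i

lemma l1_paramAt_succ_le (hπ : IsPolicyClass π) (hb : ScoreBounds π G B) (hμ : 0 < μ) (hμG : μ ≤ G ^ 2)
    (hγ : ∀ k, I.γ k = 6 * G / (μ * ((k : ℝ) + 2)))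
    (hI : 0 < I.half) (q : ℕ → unitInterval) (x : Traj S A) (n : ℕ) (s : S) :
    l1 (π (M.paramAt π I q x (n + 1)) s - π (M.paramAt π I q x n) s) ≤
      pathBound G μ I.half (n + 1) - pathBound G μ I.half n := by
  have hz : l1 (0 : A → ℝ) = 0 := by simp [l1]
  have hlt : n % (2 * I.half) < 2 * I.half := Nat.mod_lt _ (by lia)
  have hdm := Nat.div_add_mod n (2 * I.half)
  simp only [MDP.paramAt, pathBound]
  set k := n / (2 * I.half)
  set i := n % (2 * I.half)
  by_cases hi : i + 1 < 2 * I.half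
  · have hd : (n + 1) / (2 * I.half) = k := by
      rw [← hdm, add_assoc, Nat.mul_add_div (by lia), Nat.div_eq_of_lt hi, add_zero]
    have hm : (n + 1) % (2 * I.half) = i + 1 := by
      rw [← hdm, add_assoc, Nat.mul_add_mod, Nat.mod_eq_of_lt hi]
    rw [hd, hm]
    by_cases h1 : i + 1 < I.half
    · have h2 : i < I.half := by lia
      simp [h1, h2, hz]
    · by_cases h2 : i < I.half
      · simp only [h1, h2, if_true, if_false]
        refine (l1_mid_le hπ hb hμ hμG hγ q x k _ s).trans (le_of_eq ?_)
        rw [sum_range_succ]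
        ring
      · simp [h1, h2, hz]
  -- At an epoch boundary the policy moves from the intermediate parameter to the new one, compared
  -- through the old current parameter.
  · have hd : (n + 1) / (2 * I.half) = k + 1 := by
      rw [← hdm, add_assoc, show i + 1 = 2 * I.half by lia, Nat.mul_add_div (by lia),
        Nat.div_self (by lia)]
    have hm : (n + 1) % (2 * I.half) = 0 := by
      rw [← hdm, add_assoc, show i + 1 = 2 * I.half by lia, Nat.mul_add_mod, Nat.mod_self]
    have h2 : ¬ i < I.half := by lia
    rw [hd, hm]
    simp only [hI, h2, if_true, if_false]
    have h1 := l1_cur_succ_le (M := M) hπ hb hμ hγ q x k s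
    have h3 := l1_mid_le (M := M) hπ hb hμ hμG hγ q x k (q (k + 1)) s
    have h4 := l1_sub_le (π (M.memory π I q x (k + 1)).cur s - π (M.memory π I q x k).cur s)
      (π ((M.memory π I q x k).mid (q (k + 1))) s - π (M.memory π I q x k).cur s)
    rw [sub_sub_sub_cancel_right] at h4
    refine h4.trans ?_
    rw [sum_range_succ _ (k + 1), sum_range_succ _ k]
    linarith

/-- Each term is at most `√(n + 1) - √n`, by `(√(n + 1) - 1)² ≥ 0`. Logarithmic growth is not
needed, since the target is of order `√T`. -/
lemma sum_one_div_add_two_le (n : ℕ) : ∑ k ∈ range n, 1 / ((k : ℝ) + 2) ≤ √n := by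
  induction n with
  | zero => simp
  | succ n ih =>
    rw [sum_range_succ]
    have h0 : (0 : ℝ) ≤ n := Nat.cast_nonneg n
    have hs1 := Real.sq_sqrt (show (0 : ℝ) ≤ n + 1 by positivity)
    have hs0 := Real.sq_sqrt h0
    have hp : 0 ≤ √(n : ℝ) := Real.sqrt_nonneg _
    have hle : √(n : ℝ) ≤ √((n : ℝ) + 1) := Real.sqrt_le_sqrt (by linarith)
    have h1 : 1 / ((n : ℝ) + 2) ≤ √((n : ℝ) + 1) - √n := by
      rw [div_le_iff₀ (by positivity)]
      nlinarith [sq_nonneg (√((n : ℝ) + 1) - 1)]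
    push_cast
    linarith

/-- Epochs have length at least two, so at most `T` terms occur in each of the three sums; every sum
is at most `6 (G² / μ) √T`. -/
lemma pathBound_le (hμ : 0 < μ) {half T : ℕ} (hh : 0 < half) (hT : 2 ≤ T) :
    pathBound G μ half T ≤ 18 * (G ^ 2 / μ) * √T := by
  have hsum : ∀ n, ∑ i ∈ range n, stepBound G μ i ≤ 6 * (G ^ 2 / μ) * √n := by
    intro n
    have h : ∑ i ∈ range n, stepBound G μ i =
        6 * (G ^ 2 / μ) * ∑ k ∈ range n, 1 / ((k : ℝ) + 2) := by
      rw [mul_sum]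
      exact sum_congr rfl fun k _ => by rw [stepBound]; ring
    rw [h]
    exact mul_le_mul_of_nonneg_left (sum_one_div_add_two_le n) (by positivity)
  have hk : T / (2 * half) + 1 ≤ T := by
    have : T / (2 * half) ≤ T / 2 := Nat.div_le_div_left (by lia) (by norm_num)
    lia
  have h1 : ∑ i ∈ range (T / (2 * half) + 1), stepBound G μ i ≤ 6 * (G ^ 2 / μ) * √T := by
    refine (hsum _).trans (mul_le_mul_of_nonneg_left (Real.sqrt_le_sqrt ?_) (by positivity))
    exact_mod_cast hk
  have h2 : ∑ i ∈ range (T / (2 * half)), stepBound G μ i ≤ 6 * (G ^ 2 / μ) * √T := by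
    refine le_trans ?_ h1
    exact sum_le_sum_of_subset_of_nonneg (range_mono (by lia)) fun i _ _ => stepBound_nonneg hμ i
  simp only [pathBound]
  split_ifs <;> linarith

lemma pathBound_zero_nonneg (hμ : 0 < μ) (half : ℕ) : 0 ≤ pathBound G μ half 0 := by
  have h : ∀ n, 0 ≤ ∑ i ∈ range n, stepBound G μ i := fun n =>
    sum_nonneg fun i _ => stepBound_nonneg hμ i
  simp only [pathBound]
  split_ifs
  · linarith [h (0 / (2 * half)), h (0 / (2 * half) + 1)]
  · linarith [h (0 / (2 * half)), h (0 / (2 * half) + 1)]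

end PathLength

/-! ### Measurability in the random numbers and integrability -/

section Measurability

variable {S A : Type*} [Fintype S] [DecidableEq S] [Nonempty S] [Fintype A] [DecidableEq A]
  [Nonempty A] {M : MDP S A} {d : ℕ} {π : Param d → S → A → ℝ} {I : Input d} {G B μ : ℝ}

lemma measurable_gradient (f : Param d → ℝ) : Measurable (gradient f) :=
  (InnerProductSpace.toDual ℝ (Param d)).symm.continuous.measurable.comp (measurable_fderiv ℝ f)

lemma measurable_score (π : Param d → S → A → ℝ) (s : S) (a : A) :
    Measurable fun θ => score π θ s a :=
  measurable_gradient _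

lemma measurable_policy (hπ : IsPolicyClass π) (hb : ScoreBounds π G B) (s : S) (a : A) :
    Measurable fun θ => π θ s a :=
  (continuous_policy hπ hb s a).measurable

lemma measurable_gradEst (hπ : IsPolicyClass π) (hb : ScoreBounds π G B) (len N : ℕ)
    (τ : Traj S A) : Measurable fun θ => M.gradEst π len N θ τ := by
  have h : ∀ s a, Measurable fun θ => M.Ahat (π θ) τ len N s a • score π θ s a := by
    intro s a
    have h1 : Measurable fun θ => M.Ahat (π θ) τ len N s a :=
      (measurable_const.div (measurable_policy hπ hb s a)).sub measurable_const
    exact h1.smul (measurable_score π s a)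
  exact (Finset.measurable_fun_sum _ fun t _ => h _ _).fun_const_smul _

/-- The Hessian need not be continuous, but derivatives of functions on `ℝ^d` are always measurable.
-/
lemma measurable_hessEst {Ω : Type*} [MeasurableSpace Ω] (len N : ℕ) (τ : Traj S A)
    {f g : Ω → Param d} (hf : Measurable f) (hg : Measurable g) :
    Measurable fun ω => M.hessEst π len N (f ω) τ (g ω) := by
  have h1 : Measurable fun θ => gradLogProb π len θ τ :=
    Finset.measurable_fun_sum _ fun t _ => measurable_score π _ _
  have h2 : Measurable fun θ => hessian (M.Phi π len N τ) θ := measurable_fderiv ℝ _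
  have h3 := measurable_gradient (M.Phi π len N τ)
  refine Measurable.add ?_ ?_
  · exact (Measurable.inner (𝕜 := ℝ) (h1.comp hf) hg).smul (h3.comp hf)
  · exact ContinuousLinearMap.measurable_apply₂.comp ((h2.comp hf).prodMk hg)

lemma measurable_mid {m : (ℕ → unitInterval) → Memory d} (h1 : Measurable fun q => (m q).prev)
    (h2 : Measurable fun q => (m q).cur) (k : ℕ) : Measurable fun q => (m q).mid (q k) := by
  have hq : Measurable fun q : ℕ → unitInterval => (q k : ℝ) :=
    measurable_subtype_coe.comp (measurable_pi_apply k)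
  exact (hq.smul h2).add ((measurable_const.sub hq).smul h1)

lemma measurable_memory (hπ : IsPolicyClass π) (hb : ScoreBounds π G B) (x : Traj S A) (k : ℕ) :
    (Measurable fun q => (M.memory π I q x k).prev) ∧
    (Measurable fun q => (M.memory π I q x k).cur) ∧
    (Measurable fun q => (M.memory π I q x k).dir) := by
  induction k with
  | zero => exact ⟨measurable_const, measurable_const, measurable_const⟩
  | succ k ih =>
    obtain ⟨h1, h2, h3⟩ := ih
    have hdir : Measurable fun q => (M.memory π I q x (k + 1)).dir := by
      have hH : Measurable fun q => M.hessEst π I.half I.N ((M.memory π I q x k).mid (q (k + 1)))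
          (fun i => x (k * (2 * I.half) + I.half + i))
          ((M.memory π I q x k).cur - (M.memory π I q x k).prev) :=
        measurable_hessEst _ _ _ (measurable_mid h1 h2 (k + 1)) (h2.sub h1)
      have hg : Measurable fun q => M.gradEst π I.half I.N (M.memory π I q x k).cur
          (fun i => x (k * (2 * I.half) + i)) :=
        (measurable_gradEst (M := M) hπ hb I.half I.N
          fun i => x (k * (2 * I.half) + i)).comp h2
      simp only [MDP.memory, MDP.direction]
      exact ((h3.add hH).fun_const_smul _).add (hg.fun_const_smul _)
    exact ⟨h2, h2.add ((measurable_const.div hdir.norm).smul hdir), hdir⟩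

lemma measurable_paramAt (hπ : IsPolicyClass π) (hb : ScoreBounds π G B) (x : Traj S A) (t : ℕ) :
    Measurable fun q => M.paramAt π I q x t := by
  obtain ⟨h1, h2, -⟩ := measurable_memory (M := M) (I := I) hπ hb x (t / (2 * I.half))
  simp only [MDP.paramAt]
  split_ifs
  exacts [h2, measurable_mid h1 h2 _]

lemma integrable_condRegret (hπ : IsPolicyClass π) (hb : ScoreBounds π G B) (Jstar : ℝ) (T : ℕ) :
    Integrable (M.condRegret π I Jstar T) uniformLaw := by
  have : IsProbabilityMeasure uniformLaw := by
    unfold uniformLaw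
    infer_instance
  refine integrable_finsetSum _ fun x _ => Integrable.mul_const ?_ _
  refine Integrable.of_bound (Measurable.aestronglyMeasurable ?_) 1 (Eventually.of_forall fun q => ?_)
  · refine Finset.measurable_fun_prod _ fun t _ => Measurable.const_mul ?_ _
    exact (measurable_policy hπ hb _ _).comp (measurable_paramAt hπ hb _ t)
  · rw [Real.norm_of_nonneg (runProb_nonneg hπ q T _)]
    exact runProb_le_one hπ q T _

end Measurability

/-! ### The regret bound given the random numbers -/

section Regret

variable {S A : Type*} [Fintype S] [DecidableEq S] [Nonempty S] [Fintype A] [DecidableEq A]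
  [Nonempty A] {M : MDP S A} {d : ℕ} {π : Param d → S → A → ℝ} {I : Input d} {G B μ : ℝ}

/-- Near-optimality pays `√ε` per step and the tracking bound pays the rest: `2 * (16/3) t_mix` from
the two ends and `11 * 18 = 198` from the path length, together at most `209`. -/
lemma condRegret_le (hM : M.Ergodic) (hπ : IsPolicyClass π) (hb : ScoreBounds π G B)
    {πstar : S → A → ℝ} (hs : IsPolicy πstar) {ε : ℝ} (hε : M.TransferErrorLe π πstar ε)
    (hμ : 0 < μ) (hF : M.FisherNondegenerate π μ) (hd : 0 < d) (hI : 0 < I.half)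
    (hγ : ∀ k, I.γ k = 6 * G / (μ * ((k : ℝ) + 2))) {T : ℕ} (hT : 2 ≤ T)
    (q : ℕ → unitInterval) :
    M.condRegret π I (M.J πstar) T q ≤
      T * √ε + 209 * (M.tmix π : ℝ) ^ 2 * (G ^ 2 / μ) * √T := by
  obtain ⟨ht, hmix⟩ := tmix_spec hM fun θ => (hπ θ).1
  have ht' : (1 : ℝ) ≤ M.tmix π := by exact_mod_cast ht
  have hμG : μ ≤ G ^ 2 := mul_le_sq_score_bound hπ hb hF hd
  have hratio : 1 ≤ G ^ 2 / μ := (one_le_div hμ).2 hμG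
  have hu : ∀ θ s, |relCost M π θ s| ≤ 16 / 3 * M.tmix π := by
    intro θ s
    have h1 := abs_V_le hM (hπ θ).1 (hmix θ) s
    have h2 := abs_V_le hM (hπ θ).1 (hmix θ) (Classical.arbitrary S)
    refine (abs_sub _ _).trans ?_
    linarith
  have hb' : ∀ n x s, relCost M π (M.paramAt π I q x (n + 1)) s -
      relCost M π (M.paramAt π I q x n) s ≤ 11 * (M.tmix π : ℝ) ^ 2 *
        (pathBound G μ I.half (n + 1) - pathBound G μ I.half n) := by
    intro n x s
    have h := abs_V_sub_V_le hM (hπ (M.paramAt π I q x n)).1 (hπ (M.paramAt π I q x (n + 1))).1 ht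
      (hmix _) (hmix _) (fun s => l1_paramAt_succ_le (M := M) hπ hb hμ hμG hγ hI q x n s) s
      (Classical.arbitrary S)
    simp only [relCost]
    linarith [(abs_le.1 h).1]
  have hloss := runExp_sum_J_sub_r_le hM hπ hI q hu hb' T
  rw [← mul_sum, sum_range_sub] at hloss
  have hgap : M.condRegret π I (M.J πstar) T q ≤ runExp M π I q T (fun _ => T * √ε) +
      runExp M π I q T (fun x => ∑ t ∈ range T,
        (M.J (π (M.paramAt π I q x t)) - M.r (x t).1 (x t).2)) := by
    rw [← runExp_add]
    refine runExp_mono (f := M.regret (M.J πstar) T) hπ q T fun x => ?_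
    have hc : (T : ℝ) * √ε = ∑ _t ∈ range T, √ε := by simp
    rw [hc, ← sum_add_distrib]
    refine sum_le_sum fun t _ => ?_
    linarith [J_sub_le_sqrt hM hπ hb hs hε hμ hF (M.paramAt π I q x t)]
  rw [runExp_const hI hπ] at hgap
  have hpath : pathBound G μ I.half T - pathBound G μ I.half 0 ≤ 18 * (G ^ 2 / μ) * √T := by
    linarith [pathBound_le (G := G) hμ hI hT, pathBound_zero_nonneg (G := G) hμ I.half]
  have h1 : 11 * (M.tmix π : ℝ) ^ 2 * (pathBound G μ I.half T - pathBound G μ I.half 0) ≤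
      11 * (M.tmix π : ℝ) ^ 2 * (18 * (G ^ 2 / μ) * √T) := by gcongr
  have hsqrt : 1 ≤ √(T : ℝ) := Real.one_le_sqrt.2 (by exact_mod_cast (by lia : 1 ≤ T))
  have h2 : (M.tmix π : ℝ) ≤ (M.tmix π : ℝ) ^ 2 * (G ^ 2 / μ) * √T := by
    have ha : (M.tmix π : ℝ) ≤ (M.tmix π : ℝ) ^ 2 := by nlinarith
    have hb : (1 : ℝ) ≤ G ^ 2 / μ * √T := one_le_mul_of_one_le_of_one_le hratio hsqrt
    rw [mul_assoc]
    nlinarith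
  linarith

end Regret

end AvgRewardPG

/-! ### Comparison with the stated bound -/

theorem theorem2 :
    ∃ C : ℝ, 0 < C ∧
      ∀ (S A : Type*) [Fintype S] [DecidableEq S] [Nonempty S]
        [Fintype A] [DecidableEq A] [Nonempty A]
        (M : MDP S A) (d : ℕ) (π : Param d → S → A → ℝ) (πstar : S → A → ℝ)
        (G B μ ε : ℝ) (θ₀ θ₁ : Param d) (T : ℕ),
        0 < d → 2 ≤ T →
        M.Ergodic → IsPolicyClass π → M.IsOptimal πstar →
        ScoreBounds π G B →
        M.TransferErrorLe π πstar ε →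
        0 < μ → M.FisherNondegenerate π μ →
        Integrable (M.condRegret π (M.input π G μ T θ₀ θ₁) (M.J πstar) T) uniformLaw ∧
        M.expRegret π (M.input π G μ T θ₀ θ₁) (M.J πstar) T ≤
          T * √ε +
          C * (√(Fintype.card A) * G ^ 2 * M.tmix π * Real.log T / μ * √T +
            √(Fintype.card A) * G ^ 4 * M.thit π * (M.tmix π : ℝ) ^ 2 *
              Real.log T ^ (3 / 2 : ℝ) / μ ^ 2 * √T +
            √(Fintype.card A) * (B * G + G ^ 3) * M.tmix π * Real.log T / μ ^ 2 * √T) := by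
  refine ⟨1000, by norm_num, ?_⟩
  intro S A _ _ _ _ _ _ M d π πstar G B μ ε θ₀ θ₁ T hd hT hM hπ hs hb hε hμ hF
  have hint := integrable_condRegret (M := M) (I := M.input π G μ T θ₀ θ₁) hπ hb (M.J πstar) T
  refine ⟨hint, ?_⟩
  have hprob : IsProbabilityMeasure uniformLaw := by
    unfold uniformLaw
    infer_instance
  obtain ⟨hG, hB⟩ := scoreBounds_nonneg hb
  have ht : (1 : ℝ) ≤ M.tmix π := by exact_mod_cast (tmix_spec hM fun θ => (hπ θ).1).1
  have hh : 1 ≤ M.thit π := one_le_thit hM fun θ => (hπ θ).1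
  have hT' : (2 : ℝ) ≤ T := by exact_mod_cast hT
  have hlog : 1 / 2 ≤ Real.log T := by
    have h1 := Real.log_two_gt_d9
    have h2 := Real.log_le_log (by norm_num) hT'
    linarith
  have hI : 0 < (M.input π G μ T θ₀ θ₁).half := by
    simp only [MDP.input, Nat.ceil_pos]
    have : 0 < Real.logb 2 T := Real.logb_pos (by norm_num) (by linarith)
    positivity
  have hle : M.expRegret π (M.input π G μ T θ₀ θ₁) (M.J πstar) T ≤
      T * √ε + 209 * (M.tmix π : ℝ) ^ 2 * (G ^ 2 / μ) * √T := by
    refine (integral_mono hint (integrable_const _) fun q =>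
      condRegret_le hM hπ hb hs.1 hε hμ hF hd hI (fun _ => rfl) hT q).trans (le_of_eq ?_)
    simp
  refine hle.trans (add_le_add_right ?_ _)
  have hratio : 1 ≤ G ^ 2 / μ := (one_le_div hμ).2 (mul_le_sq_score_bound hπ hb hF hd)
  have hA : 1 ≤ √(Fintype.card A : ℝ) :=
    Real.one_le_sqrt.2 (by exact_mod_cast Fintype.card_pos (α := A))
  have hlog' : 1 / 4 ≤ Real.log T ^ (3 / 2 : ℝ) := by
    calc (1 / 4 : ℝ) = (1 / 2 : ℝ) ^ (2 : ℝ) := by norm_num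
      _ ≤ (1 / 2 : ℝ) ^ (3 / 2 : ℝ) :=
          Real.rpow_le_rpow_of_exponent_ge (by norm_num) (by norm_num) (by norm_num)
      _ ≤ _ := Real.rpow_le_rpow (by norm_num) hlog (by norm_num)
  have hlog0 : 0 ≤ Real.log T := by linarith
  -- Only the second term of the bound is used. Its surplus factor is at least `1/4`, because `log T
  -- ≥ 1/2`, and `4 * 209 ≤ 1000`.
  have hmain : 209 * (M.tmix π : ℝ) ^ 2 * (G ^ 2 / μ) * √T ≤
      1000 * (√(Fintype.card A) * G ^ 4 * M.thit π * (M.tmix π : ℝ) ^ 2 *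
        Real.log T ^ (3 / 2 : ℝ) / μ ^ 2 * √T) := by
    have e : 1000 * (√(Fintype.card A) * G ^ 4 * M.thit π * (M.tmix π : ℝ) ^ 2 *
        Real.log T ^ (3 / 2 : ℝ) / μ ^ 2 * √T) =
        1000 * (M.tmix π : ℝ) ^ 2 * (G ^ 2 / μ) * √T *
          (√(Fintype.card A) * (G ^ 2 / μ) * M.thit π * Real.log T ^ (3 / 2 : ℝ)) := by
      field_simp
    have hone : (1 / 4 : ℝ) ≤
        √(Fintype.card A) * (G ^ 2 / μ) * M.thit π * Real.log T ^ (3 / 2 : ℝ) := by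
      calc (1 / 4 : ℝ) = 1 * 1 * 1 * (1 / 4) := by norm_num
        _ ≤ _ := by gcongr
    rw [e]
    have hX : 0 ≤ (M.tmix π : ℝ) ^ 2 * (G ^ 2 / μ) * √T := by positivity
    nlinarith
  have h1 : 0 ≤ √(Fintype.card A) * G ^ 2 * M.tmix π * Real.log T / μ * √T := by positivity
  have h3 : 0 ≤ √(Fintype.card A) * (B * G + G ^ 3) * M.tmix π * Real.log T / μ ^ 2 * √T := by
    positivity
  linarith
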